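/- Let $X/\mathbb F_q$ be a smooth projective geometrically connected curve of genus $g$ over the field of $q<\infty$ elements, let $W$ be an algebraically closed field containing $\overline{\mathbb F}_q$, and let $\overline X=X_W$, whose closed points are identified with $X(W)$. For an integer $i$, write $\xi\mapsto\xi^{(i)}$ for the action on $\overline X$ of the $q^i$-th power automorphism of $W$, extended additively to divisors, and $f\mapsto f^{(i)}$ for the automorphism of the function field of $\overline X$ that is the $q^i$-th power map on $W$ and the identity on $\mathbb F_q(X)$. Divisors of $X$ are also regarded as divisors of $\overline X$ by base change. For an effective divisor $D$ of $X$ and divisors $A,B$ of $\overline X$ supported away from $D$, write $A\sim_D B$ if $A-B=(f)$ for a nonzero meromorphic function $f$ on $\overline X$ with $f|_D\equiv 1$. Let $(D,\xi,\eta,E)$ be a shtuka: $D$ is a nonzero effective divisor of $X$, $\xi,\eta\in\overline X\setminus\operatorname{supp}D$, $E$ is a divisor of $\overline X$ supported away from $D$, $E-E^{(1)}\sim_D-\xi^{(1)}+\eta$, and $\deg E=g-1$. Assume that it is nondegenerate: $\eta\neq\xi^{(i)}$ for all integers $i$ with $1-\deg(E+D)\le i\le g$. Let $\Psi$ be the set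 of $\psi\in H^0(\mathcal O_{\overline X}(E+D))$ such that $\psi-\psi^{(1)}$ is regular in a neighborhood of $D$. Each $\alpha\in H^0(\mathcal O_X(D)/\mathcal O_X)$ has a unique lifting $\psi_\alpha\in\Psi$, i.e. a unique $\psi_\alpha\in\Psi$ whose class in $H^0(\mathcal O_{\overline X}(D)/\mathcal O_{\overline X})$ is the image of $\alpha$. For nonzero $\alpha,\beta$ the Catalan–Drinfeld symbol is $$\left[\begin{array}{cccc}D&\xi&\eta&E\\&\alpha&\beta&\end{array}\right]=(\psi_\alpha/\psi_\beta)(\xi).$$ Fix nonzero $\alpha,\beta\in H^0(\mathcal O_X(D)/\mathcal O_X)$. Suppose $E=E_1-E_2$, where $E_1,E_2$ are divisors of $\overline X$ supported away from $D$, $E_2$ is effective and of multiplicity $\le 1$ everywhere, and the sets $\operatorname{supp}E_1$, $\operatorname{supp}E_2$ and $\{\xi\}$ are pairwise disjoint. Write $E_2=\sum_{i=1}^n\xi_i$ with $n=\deg E_2$, and put $\xi_0=\xi$. Let $f_1,\dots,f_n$ be a $W$-basis of $H^0(\mathcal O_{\overline X}(E_1))$, let $\tilde\alpha,\tilde\beta\in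 H^0(\mathcal O_{\overline X}(E_1+D))$ be liftings of $\alpha$ and $\beta$, and put $f_0=\tilde\alpha$, $g_0=\tilde\beta$ and $g_i=f_i$ for $1\le i\le n$. **Proposition.** One has $$\det_{i,j=0}^n g_i(\xi_j)\cdot\left[\begin{array}{cccc}D&\xi&\eta&E\\&\alpha&\beta&\end{array}\right]=\det_{i,j=0}^n f_i(\xi_j),$$ and neither of the two determinants vanishes. -/

import Mathlib

open scoped TensorProduct WithZero

noncomputable section

namespace Shtuka

/-! ## Curves, points and divisors

A smooth projective connected curve over a perfect field `k` is given by its function field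
`K`, a function field in one variable over `k`. Its closed points are the discrete valuation
rings of `K` containing `k` (each such ring is the local ring of exactly one closed point). -/

section Curve

variable (k K : Type*) [Field k] [Field K] [Algebra k K]

/-- `K` is a function field in one variable over `k`: a finite extension of `k(t)` for some
`t ∈ K` transcendental over `k`. -/
def IsFunctionFieldOne : Prop :=
  ∃ t : K, Transcendental k t ∧ FiniteDimensional (IntermediateField.adjoin k {t}) K

/-- A closed point of the smooth projective curve over `k` with function field `K`, given by
its local ring. -/
@[ext]
structure Point where
  /-- the local ring of functions regular at the point -/
  ring : ValuationSubring K
  algebraMap_mem : ∀ c : k, algebraMap k K c ∈ ring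
  dvr : IsDiscreteValuationRing ring

/-- Divisors: the free abelian group on the closed points. -/
abbrev Divisor : Type _ := Point k K →₀ ℤ

variable {k K}

/-- The normalized valuation at `x`, written multiplicatively:
`x.val f = exp (- ord_x f)` for `f ≠ 0`, and `x.val 0 = 0`. -/
def Point.val (x : Point k K) : Valuation K ℤᵐ⁰ :=
  haveI := x.dvr
  (IsDiscreteValuationRing.maximalIdeal x.ring).valuation K

theorem Point.val_le_one_of_mem (x : Point k K) {f : K} (hf : f ∈ x.ring) : x.val f ≤ 1 :=
  haveI := x.dvr
  (IsDiscreteValuationRing.maximalIdeal x.ring).valuation_le_one (⟨f, hf⟩ : x.ring)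

theorem Point.val_smul_le (x : Point k K) (c : k) (f : K) : x.val (c • f) ≤ x.val f := by
  rw [Algebra.smul_def, map_mul]
  exact mul_le_of_le_one_left' (x.val_le_one_of_mem (x.algebraMap_mem c))

/-- The functions `f` with `ord_x f + N x ≥ 0` for all `x ∈ S`, as a `k`-vector space. -/
def functionsOn (S : Set (Point k K)) (N : Point k K → ℤ) : Submodule k K where
  carrier := {f | ∀ x ∈ S, x.val f ≤ WithZero.exp (N x)}
  zero_mem' := fun x _ => by simp
  add_mem' := fun {a b} ha hb x hx =>
    (Valuation.map_add x.val a b).trans (max_le (ha x hx) (hb x hx))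
  smul_mem' := fun c f hf x hx => (x.val_smul_le c f).trans (hf x hx)

/-- The Riemann-Roch space `H⁰(𝒪(E))`. -/
def H0 (E : Divisor k K) : Submodule k K := functionsOn Set.univ E

/-- The functions having, at each point of the support of the effective divisor `D`, a pole of
order at most the multiplicity of `D`: sections of `𝒪(D)` over neighborhoods of `D`. -/
def polesAlong (D : Divisor k K) : Submodule k K := functionsOn (D.support : Set (Point k K)) D

/-- The functions regular at each point of the support of `D`, that is, regular in some
neighborhood of `D`. -/
def regularAlong (D : Divisor k K) : Submodule k K :=
  functionsOn (D.support : Set (Point k K)) 0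

/-- `H⁰(𝒪(D)/𝒪)` for an effective divisor `D`: the sheaf `𝒪(D)/𝒪` is supported on the finite set
`supp D`, so its global sections are the sections of `𝒪(D)` near `supp D` modulo those
of `𝒪`. -/
abbrev PrincipalParts (D : Divisor k K) : Type _ :=
  polesAlong D ⧸ (regularAlong D).submoduleOf (polesAlong D)

/-- The divisor `E` is supported away from `D`. -/
def Away (D E : Divisor k K) : Prop := Disjoint D.support E.support

/-- `f|_D ≡ 1`. -/
def IsOneOn (D : Divisor k K) (f : K) : Prop :=
  ∀ x ∈ D.support, x.val (f - 1) ≤ WithZero.exp (-(D x))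

/-- `E = (f)` is the divisor of the nonzero function `f`. -/
def IsDivisorOf (E : Divisor k K) (f : K) : Prop :=
  f ≠ 0 ∧ ∀ x, x.val f = WithZero.exp (-(E x))

/-- `E₁ ∼_D E₂`: the divisors `E₁` and `E₂` (supported away from `D`) belong to the same
generalized divisor class of conductor `D`. -/
def ClassEq (D E₁ E₂ : Divisor k K) : Prop :=
  ∃ f : K, IsOneOn D f ∧ IsDivisorOf (E₁ - E₂) f

end Curve

/-! ## Invariants of a curve over an algebraically closed field -/

section AlgClosed

variable {W F : Type*} [Field W] [Field F] [Algebra W F]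

/-- The degree of a divisor on a curve over an algebraically closed field (where all closed
points have degree one). -/
def degree (E : Divisor W F) : ℤ := E.sum fun _ m => m

variable (W F) in
/-- The genus of a curve over an algebraically closed field: the maximum of
`deg A + 1 - h⁰(𝒪(A))` over all divisors `A`. -/
def genus : ℤ :=
  sSup (Set.range fun A : Divisor W F => degree A + 1 - (Module.finrank W (H0 A) : ℤ))

open Classical in
/-- The value `f(x)` in the field of constants of a function `f` regular at `x`, for a curve over
an algebraically closed field: the unique constant `c` such that `f - c` vanishes at `x`.
The value is `0` by convention if `f` has a pole at `x`. -/
def evalAt (x : Point W F) (f : F) : W :=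
  if h : ∃ c : W, x.val (f - algebraMap W F c) < 1 then h.choose else 0

end AlgClosed

/-! ## Base change to the universal domain and twisting

`k` is the finite field of `q` elements, `K` the function field of the curve `X` over `k`, and
`W` an algebraically closed field containing `k`. That `X` is geometrically connected means that
`W ⊗ K` is a domain. -/

section BaseChange

variable (k K W : Type*) [Field k] [Field K] [Algebra k K] [Field W] [Algebra k W]

/-- The function field of the curve `X̄ = X_W`. -/
abbrev FBar : Type _ := FractionRing (W ⊗[k] K)

/-- The inclusion of the function field of `X` in the function field of `X̄`. -/
def incl : K →+* FBar k K W :=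
  (algebraMap (W ⊗[k] K) (FBar k K W)).comp
    (Algebra.TensorProduct.includeRight : K →ₐ[k] W ⊗[k] K).toRingHom

/-- The `q`-th power automorphism of `W`, where `q` is the number of elements of `k`. -/
def frobW [Fintype k] [IsAlgClosed W] : W ≃ₐ[k] W :=
  AlgEquiv.ofBijective (FiniteField.frobeniusAlgHom k W)
    ⟨(FiniteField.frobeniusAlgHom k W).toRingHom.injective, fun x => by
      obtain ⟨z, hz⟩ := IsAlgClosed.exists_pow_nat_eq x (Fintype.card_pos (α := k))
      exact ⟨z, by simpa [FiniteField.coe_frobeniusAlgHom] using hz⟩⟩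

section Points

variable [IsDomain (W ⊗[k] K)]

/-- The closed points of `X̄`, that is, the `W`-valued points of `X`. -/
abbrev PointBar : Type _ := Point W (FBar k K W)

/-- The divisors of `X̄`. -/
abbrev DivisorBar : Type _ := Divisor W (FBar k K W)

variable {k K W} in
/-- `Dbar` is the divisor of `X̄` obtained from the divisor `D` of `X` by base change: at each
point `y` of `X̄` above a closed point `x` of `X`, a local equation of `D` at `x` is a local
equation of `Dbar` at `y`; and `Dbar` has multiplicity zero at the points of `X̄` above the
generic point of `X`. -/
def IsBaseChange (D : Divisor k K) (Dbar : DivisorBar k K W) : Prop :=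
  (∀ (y : PointBar k K W) (x : Point k K), y.ring.comap (incl k K W) = x.ring →
      ∀ a : K, x.val a = WithZero.exp (-(D x)) →
        y.val (incl k K W a) = WithZero.exp (-(Dbar y))) ∧
    ∀ y : PointBar k K W, (∀ x : Point k K, y.ring.comap (incl k K W) ≠ x.ring) → Dbar y = 0

end Points

variable [Fintype k] [IsAlgClosed W]

/-- One-fold twisting of functions: the automorphism of the function field of `X̄` that is the
`q`-th power automorphism on `W` and the identity on the function field of `X`. -/
def frobF : RingAut (FBar k K W) :=
  IsFractionRing.ringEquivOfRingEquiv (A := W ⊗[k] K) (B := W ⊗[k] K)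
    (K := FBar k K W) (L := FBar k K W)
    (Algebra.TensorProduct.congr (frobW k W) (AlgEquiv.refl : K ≃ₐ[k] K)).toRingEquiv

theorem frobF_incl (a : K) : frobF k K W (incl k K W a) = incl k K W a := by
  simp [frobF, incl]

theorem frobF_algebraMap (c : W) :
    frobF k K W (algebraMap W (FBar k K W) c) =
      algebraMap W (FBar k K W) (c ^ Fintype.card k) := by
  rw [IsScalarTower.algebraMap_apply W (W ⊗[k] K) (FBar k K W),
    IsScalarTower.algebraMap_apply W (W ⊗[k] K) (FBar k K W)]
  simp only [frobF, IsFractionRing.ringEquivOfRingEquiv_algebraMap,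
    Algebra.TensorProduct.algebraMap_apply, Algebra.algebraMap_self, RingHom.id_apply]
  congr 1

variable {k K W}

/-- `n`-fold twisting `f ↦ f⁽ⁿ⁾` of functions, for an integer `n` of any sign. -/
def twistFun (n : ℤ) : FBar k K W ≃+* FBar k K W := frobF k K W ^ n

theorem twistFun_algebraMap (n : ℤ) (c : W) :
    ∃ d : W, twistFun (k := k) (K := K) n (algebraMap W (FBar k K W) c) =
      algebraMap W (FBar k K W) d := by
  have hnat : ∀ (m : ℕ) (c : W), ∃ d : W, (frobF k K W ^ m) (algebraMap W (FBar k K W) c) =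
      algebraMap W (FBar k K W) d := by
    intro m
    induction m with
    | zero => exact fun c => ⟨c, rfl⟩
    | succ m ih =>
      intro c
      obtain ⟨d, hd⟩ := ih (c ^ Fintype.card k)
      exact ⟨d, by rw [pow_succ, RingAut.mul_apply, frobF_algebraMap, hd]⟩
  have hneg : ∀ (m : ℕ) (c : W), ∃ d : W,
      (frobF k K W ^ m)⁻¹ (algebraMap W (FBar k K W) c) = algebraMap W (FBar k K W) d := by
    intro m
    induction m with
    | zero => exact fun c => ⟨c, rfl⟩
    | succ m ih =>
      intro c
      obtain ⟨z, hz⟩ := IsAlgClosed.exists_pow_nat_eq c (Fintype.card_pos (α := k))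
      obtain ⟨d, hd⟩ := ih z
      refine ⟨d, ?_⟩
      rw [pow_succ', mul_inv_rev, RingAut.mul_apply, ← hd, ← hz, ← frobF_algebraMap]
      congr 1
      exact (frobF k K W).symm_apply_apply _
  obtain ⟨m, rfl | rfl⟩ := n.eq_nat_or_neg
  · simpa [twistFun] using hnat m c
  · simpa [twistFun] using hneg m c

theorem twistFun_twistFun_neg (n : ℤ) (g : FBar k K W) : twistFun n (twistFun (-n) g) = g := by
  rw [twistFun, twistFun, ← RingAut.mul_apply, ← zpow_add, add_neg_cancel, zpow_zero]
  rfl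

variable [IsDomain (W ⊗[k] K)]

/-- `n`-fold twisting `x ↦ x⁽ⁿ⁾` of points: the local ring at `x⁽ⁿ⁾` is the image under `n`-fold
twisting of functions of the local ring at `x` (that is, its preimage under `(-n)`-fold twisting),
so that `f⁽ⁿ⁾(x⁽ⁿ⁾) = f(x) ^ (q ^ n)`; in coordinates this applies the `qⁿ`-th power automorphism
of `W` to `x`. -/
def Point.twist (n : ℤ) (x : PointBar k K W) : PointBar k K W where
  ring := x.ring.comap (twistFun (k := k) (K := K) (W := W) (-n)).toRingHom
  algebraMap_mem := fun c => by
    obtain ⟨d, hd⟩ := twistFun_algebraMap (k := k) (K := K) (-n) c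
    change twistFun (-n) (algebraMap W (FBar k K W) c) ∈ x.ring
    rw [hd]
    exact x.algebraMap_mem d
  dvr := by
    have := x.dvr
    have e : x.ring ≃+* x.ring.comap (twistFun (k := k) (K := K) (W := W) (-n)).toRingHom :=
      { toFun := fun a => ⟨twistFun n a.1, by
          change twistFun (-n) (twistFun n a.1) ∈ x.ring
          have h := twistFun_twistFun_neg (-n) a.1
          rw [neg_neg] at h
          rw [h]
          exact a.2⟩
        invFun := fun b => ⟨twistFun (-n) b.1, b.2⟩
        left_inv := fun a => by
          have h := twistFun_twistFun_neg (-n) a.1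
          rw [neg_neg] at h
          exact Subtype.ext h
        right_inv := fun b => Subtype.ext (twistFun_twistFun_neg n b.1)
        map_mul' := fun a b => Subtype.ext (map_mul (twistFun n) a.1 b.1)
        map_add' := fun a b => Subtype.ext (map_add (twistFun n) a.1 b.1) }
    exact IsDiscreteValuationRing.RingEquivClass.isDiscreteValuationRing e

/-- `n`-fold twisting `E ↦ E⁽ⁿ⁾` of divisors, the additive extension of twisting of points. -/
def twistDiv (n : ℤ) (E : DivisorBar k K W) : DivisorBar k K W :=
  E.mapDomain (Point.twist n)

/-! ## Shtukas and the Catalan-Drinfeld symbol -/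

/-- The quadruple `(D, ξ, η, E)` is a shtuka. Here `Dbar` is the base change of `D` to `X̄`. -/
structure IsShtuka (D : Divisor k K) (Dbar : DivisorBar k K W) (ξ η : PointBar k K W)
    (E : DivisorBar k K W) : Prop where
  conductor_ne_zero : D ≠ 0
  conductor_effective : 0 ≤ D
  baseChange : IsBaseChange D Dbar
  basepoint_not_mem : ξ ∉ Dbar.support
  zero_not_mem : η ∉ Dbar.support
  away : Away Dbar E
  classEq : ClassEq Dbar (E - twistDiv 1 E)
    (-Finsupp.single (Point.twist 1 ξ) 1 + Finsupp.single η 1)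
  degree_eq : degree E = genus W (FBar k K W) - 1

/-- Nondegeneracy of a shtuka: `η` is not one of the points `ξ⁽ⁱ⁾` with
`1 - deg (E + D) ≤ i ≤ g`. -/
def IsNondegenerate (Dbar : DivisorBar k K W) (ξ η : PointBar k K W)
    (E : DivisorBar k K W) : Prop :=
  ∀ i : ℤ, 1 - degree (E + Dbar) ≤ i → i ≤ genus W (FBar k K W) → η ≠ Point.twist i ξ

/-- The set `Ψ` attached to a shtuka: the functions `ψ ∈ H⁰(𝒪(E + D))` such that `ψ - ψ⁽¹⁾` is
regular in some neighborhood of `D`. -/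
def Psi (Dbar E : DivisorBar k K W) : Set (FBar k K W) :=
  {ψ | ψ ∈ H0 (E + Dbar) ∧ ψ - twistFun 1 ψ ∈ regularAlong Dbar}

/-- The function `ψ` on `X̄` lifts `α ∈ H⁰(𝒪_X(D)/𝒪_X)`: its class in `H⁰(𝒪_X̄(D)/𝒪_X̄)` is the
image of `α`, that is, `ψ` differs from any function on `X` representing `α` by a function regular
in a neighborhood of `D`. -/
def Lifts {D : Divisor k K} (Dbar : DivisorBar k K W) (α : PrincipalParts D)
    (ψ : FBar k K W) : Prop :=
  ∃ a : polesAlong D, Submodule.Quotient.mk a = α ∧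
    ψ - incl k K W (a : K) ∈ regularAlong Dbar

/-- `ψ_α`, the unique lifting of `α` in `Ψ`. -/
def psiLift {D : Divisor k K} (Dbar E : DivisorBar k K W) (α : PrincipalParts D) : FBar k K W :=
  Classical.epsilon fun ψ => ψ ∈ Psi Dbar E ∧ Lifts Dbar α ψ

/-- The Catalan-Drinfeld symbol of the nondegenerate shtuka `(D, ξ, η, E)` at nonzero `α`, `β`:
the value `(ψ_α / ψ_β)(ξ)`. (The point `η` does not enter the formula.) -/
def catalanDrinfeld {D : Divisor k K} (Dbar : DivisorBar k K W) (ξ : PointBar k K W)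
    (E : DivisorBar k K W) (α β : PrincipalParts D) : W :=
  evalAt ξ (psiLift Dbar E α / psiLift Dbar E β)

end BaseChange

end Shtuka

end

/-! Let `φ ≡ 1` on `D` have divisor `E - E⁽¹⁾ + ξ⁽¹⁾ - η`, and put `τ f = f⁽¹⁾ / φ`. This semilinear
operator permits one new pole at `ξ⁽¹⁾` and forces a zero at `η` (`tau_mem_iff`). Everything rests
on two consequences of nondegeneracy.

First, `H⁰(E) = 0` (`H0_eq_bot_of_nondegenerate`). Let `Uᵢ` be the span of `τʲ H⁰(E)`, `j ≤ i`; it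
lies in `H⁰(E + ξ⁽¹⁾ + ⋯ + ξ⁽ⁱ⁾)`. If the `Uᵢ` grow strictly up to `i = g`, then `h⁰(E) + g` is at
most the dimension `g` given by Riemann-Roch in degree `2g - 1`. Otherwise some `Uᵢ` with `i < g` is
`τ`-stable, hence `τ` is bijective on it. Zeros at `η` then remove the permitted poles one by one,
produce a zero at `ξ`, and finally zeros at `η, η⁽¹⁾, …, η⁽ᵍ⁻¹⁾`, too many for degree `g - 1`. Since
`deg E = g - 1`, Riemann's inequality and `H⁰(E) = 0` make `H⁰(E + D)` isomorphic to the space of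
principal parts along `D`, which gives the liftings `ψ_α` (`exists_lift`, `existsUnique_lift`).

Second, `ψ_α(ξ) ≠ 0` for `α ≠ 0` (`val_lift_eq_one`). If `ψ_α` vanished at `ξ`, then `τ ψ_α` would
lie in `H⁰(E + D)` with the same principal part, so `τ ψ_α = ψ_α`; the zero at `ξ` would then spread
along the orbit of `η` until the degree became negative.

The determinants are now linear algebra. The function `ψ_α - α̃` is a combination of the `fᵢ`, and
`ψ_α` vanishes at `ξ₁, …, ξₙ`. A row operation turns the first row into `(ψ_α(ξ), 0, …, 0)`, so the
determinant is `ψ_α(ξ)` times the minor `det (fᵢ(ξⱼ))` with `i, j ≥ 1` (`det_evalAt_cons`). The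
minor is nonzero because a linear dependence of its rows would give an element of `H⁰(E₁ - E₂) = 0`
(`det_evalAt_ne_zero`), and it is the same for `α` and `β`.

The curve theory needed (discreteness of places, residue fields, degrees of principal divisors,
Riemann-Roch in large degree) is derived from the finiteness of `[F : W(t)]`. -/

noncomputable section

namespace Shtuka

open Polynomial

/-! ### Normalized valuations at closed points -/

section Points

variable {k K : Type*} [Field k] [Field K] [Algebra k K]

theorem Point.mem_ring_iff (x : Point k K) {f : K} : f ∈ x.ring ↔ x.val f ≤ 1 := by
  refine ⟨x.val_le_one_of_mem, fun h => ?_⟩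
  have := x.dvr
  obtain ⟨r, hr⟩ := IsDedekindDomain.HeightOneSpectrum.mem_integers_of_valuation_le_one
    (R := x.ring) K f (fun v => by
      have : v = IsDiscreteValuationRing.maximalIdeal x.ring := by
        ext1
        exact IsLocalRing.eq_maximalIdeal v.isMaximal
      rw [this]
      exact h)
  rw [← hr]
  exact r.2

theorem Point.exists_val_eq (x : Point k K) (m : ℤ) : ∃ f : K, x.val f = WithZero.exp m := by
  have := x.dvr
  exact (IsDiscreteValuationRing.maximalIdeal x.ring).valuation_surjective K _

theorem Point.val_ne_zero (x : Point k K) {f : K} (hf : f ≠ 0) : x.val f ≠ 0 :=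
  (Valuation.ne_zero_iff _).2 hf

theorem Point.exists_val_eq_exp (x : Point k K) {f : K} (hf : f ≠ 0) :
    ∃ m : ℤ, x.val f = WithZero.exp m :=
  ⟨_, (WithZero.exp_log (x.val_ne_zero hf)).symm⟩

theorem ne_zero_of_val_eq_exp (x : Point k K) {f : K} {m : ℤ} (h : x.val f = WithZero.exp m) :
    f ≠ 0 := by
  rintro rfl
  rw [map_zero] at h
  exact WithZero.exp_ne_zero h.symm

theorem lt_exp_iff {a : ℤᵐ⁰} {m : ℤ} : a < WithZero.exp m ↔ a ≤ WithZero.exp (m - 1) := by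
  rcases eq_or_ne a 0 with rfl | h
  · simp
  · rw [← WithZero.exp_log h, WithZero.exp_lt_exp, WithZero.exp_le_exp]
    omega

theorem lt_one_iff {a : ℤᵐ⁰} : a < 1 ↔ a ≤ WithZero.exp (-1) := by
  rw [← WithZero.exp_zero, lt_exp_iff, zero_sub]

/-- A discrete valuation ring is a maximal proper subring of its fraction field, so one inclusion of
local rings suffices. -/
theorem Point.ext_val {x y : Point k K} (h : ∀ f, x.val f ≤ 1 → y.val f ≤ 1) : x = y := by
  have hle : ∀ f, x.val f ≤ 1 → x.val f < 1 → y.val f < 1 := by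
    intro f _ hf
    by_contra hc
    have hy1 : y.val f = 1 := le_antisymm (h f hf.le) (not_lt.1 hc)
    obtain ⟨g, hg⟩ := y.exists_val_eq 1
    have hf0 : f ≠ 0 := by rintro rfl; simp at hy1
    have hg0 := ne_zero_of_val_eq_exp y hg
    obtain ⟨a, ha⟩ := x.exists_val_eq_exp hf0
    obtain ⟨b, hb⟩ := x.exists_val_eq_exp hg0
    have ha' : a < 0 := by
      rw [ha, ← WithZero.exp_zero, WithZero.exp_lt_exp] at hf
      exact hf
    -- A high power of `f` clears the pole of `g` at `x`, but `f` is a unit at `y`, so the pole of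
    -- `g` there survives.
    have := h (g * f ^ b.toNat) (by
      rw [map_mul, map_pow, ha, hb, ← WithZero.exp_nsmul, ← WithZero.exp_add,
        ← WithZero.exp_zero, WithZero.exp_le_exp, nsmul_eq_mul]
      have : (b.toNat : ℤ) * a ≤ (b.toNat : ℤ) * (-1) :=
        mul_le_mul_of_nonneg_left (by omega) (by positivity)
      omega)
    rw [map_mul, map_pow, hy1, hg, one_pow, mul_one, ← WithZero.exp_zero, WithZero.exp_le_exp]
      at this
    omega
  ext f
  rw [x.mem_ring_iff, y.mem_ring_iff]
  refine ⟨h f, fun hy => ?_⟩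
  by_contra hx
  rw [not_le] at hx
  have hf0 : f ≠ 0 := by rintro rfl; simp at hx
  have : x.val f⁻¹ < 1 := by
    rw [map_inv₀]
    exact inv_lt_one_of_one_lt₀ hx
  have := hle _ this.le this
  rw [map_inv₀, inv_lt_one₀ (by simpa [zero_lt_iff] using hf0)] at this
  exact absurd hy (not_le.2 this)

/-- Valuations with the same ring agree up to a positive exponent `c`; attaining `exp (-1)` forces
`c ∣ 1`. This is used to identify the valuation at a twisted point. -/
theorem Point.val_unique (x : Point k K) (v : Valuation K ℤᵐ⁰)
    (hv : ∀ f, x.val f ≤ 1 ↔ v f ≤ 1) (hπ : ∃ f, v f = WithZero.exp (-1)) : v = x.val := by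
  have hone : ∀ f, x.val f = 1 → v f = 1 := by
    intro f hf
    refine le_antisymm ((hv f).1 hf.le) ?_
    have := (hv f⁻¹).1 (by rw [map_inv₀, hf, inv_one])
    rw [map_inv₀] at this
    have h0 : f ≠ 0 := by rintro rfl; simp at hf
    exact (inv_le_one₀ (by simpa [zero_lt_iff] using h0)).1 this
  obtain ⟨π, hπ'⟩ := x.exists_val_eq 1
  have hπ0 := ne_zero_of_val_eq_exp x hπ'
  have key : ∀ f ≠ 0, ∀ m : ℤ, x.val f = WithZero.exp m → v f = v π ^ m := by
    intro f hf m hm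
    have := hone (f * π ^ (-m)) (by
      rw [map_mul, map_zpow₀, hm, hπ', ← WithZero.exp_zsmul, ← WithZero.exp_add]
      simp)
    rw [map_mul, map_zpow₀, zpow_neg] at this
    exact (div_eq_one_iff_eq (zpow_ne_zero _ (by simpa using hπ0))).1 (by rwa [div_eq_mul_inv])
  obtain ⟨c, hc⟩ : ∃ c : ℤ, v π = WithZero.exp c :=
    ⟨_, (WithZero.exp_log (by simpa using hπ0)).symm⟩
  obtain ⟨ϖ, hϖ⟩ := hπ
  have hϖ0 : ϖ ≠ 0 := by rintro rfl; rw [map_zero] at hϖ; exact WithZero.exp_ne_zero hϖ.symm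
  obtain ⟨a, ha⟩ := x.exists_val_eq_exp hϖ0
  have h1 := key ϖ hϖ0 a ha
  rw [hϖ, hc, ← WithZero.exp_zsmul, WithZero.exp_inj, smul_eq_mul] at h1
  have hc0 : 0 < c := by
    by_contra hc0
    have := (hv π).2 (by rw [hc, ← WithZero.exp_zero, WithZero.exp_le_exp]; omega)
    rw [hπ', ← WithZero.exp_zero, WithZero.exp_le_exp] at this
    omega
  have hc1 : c = 1 := by
    have : c ∣ 1 := ⟨-a, by linarith⟩
    exact Int.eq_one_of_dvd_one hc0.le this
  ext f
  rcases eq_or_ne f 0 with rfl | hf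
  · simp
  · obtain ⟨m, hm⟩ := x.exists_val_eq_exp hf
    rw [key f hf m hm, hm, hc, hc1, ← WithZero.exp_zsmul]
    simp

theorem Point.val_algebraMap (x : Point k K) {c : k} (hc : c ≠ 0) :
    x.val (algebraMap k K c) = 1 := by
  refine le_antisymm (x.val_le_one_of_mem (x.algebraMap_mem c)) ?_
  have h := x.val_le_one_of_mem (x.algebraMap_mem c⁻¹)
  rw [map_inv₀, map_inv₀] at h
  exact (inv_le_one₀ (by simpa [zero_lt_iff] using hc)).1 h

end Points

/-! ### Linear relations over `W[t]` -/

section Relations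

variable {W F : Type*} [Field W] [Field F] [Algebra W F]

/-- While all coefficients are divisible by `t`, divide by it; the degree of the chosen nonzero
coefficient drops each time. -/
theorem exists_relation_coeff_zero {t : F} (ht0 : t ≠ 0) {ι : Type*} [Fintype ι] (z : ι → F)
    (c : ι → W[X]) (i₀ : ι) (hc : c i₀ ≠ 0) (h : ∑ i, aeval t (c i) * z i = 0) :
    ∃ c : ι → W[X], (∃ i, (c i).coeff 0 ≠ 0) ∧ ∑ i, aeval t (c i) * z i = 0 := by
  induction hn : (c i₀).natDegree generalizing c with
  | zero =>
    refine ⟨c, ⟨i₀, fun h0 => hc ?_⟩, h⟩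
    rw [eq_C_of_natDegree_eq_zero hn, h0, C_0]
  | succ m ih =>
    by_cases hx : ∃ i, (c i).coeff 0 ≠ 0
    · exact ⟨c, hx, h⟩
    · push Not at hx
      choose d hd using fun i => X_dvd_iff.2 (hx i)
      have hd0 : d i₀ ≠ 0 := by
        intro h0
        rw [hd, h0, mul_zero] at hc
        exact hc rfl
      refine ih d hd0 ?_ ?_
      · have : t * ∑ i, aeval t (d i) * z i = 0 := by
          rw [← h, Finset.mul_sum]
          refine Finset.sum_congr rfl fun i _ => ?_
          rw [hd i, map_mul, aeval_X, mul_assoc]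
        exact (mul_eq_zero.1 this).resolve_left ht0
      · rw [hd, natDegree_X_mul hd0] at hn
        omega

theorem transcendental_of_notMem_range [IsAlgClosed W] {t : F}
    (ht : t ∉ (algebraMap W F).range) : Transcendental W t := by
  intro h
  have := IntermediateField.isAlgebraic_adjoin_simple (K := W) h.isIntegral
  have : Algebra.IsIntegral W (IntermediateField.adjoin W {t}) := Algebra.IsAlgebraic.isIntegral
  obtain ⟨c, hc⟩ := (IsAlgClosed.algebraMap_bijective_of_isIntegral (k := W)
    (K := IntermediateField.adjoin W {t})).2 ⟨t, IntermediateField.mem_adjoin_simple_self W t⟩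
  exact ht ⟨c, congrArg Subtype.val hc⟩

variable (W) in
/-- The degree of `F` over its subfield `W(t)`. -/
def extDegree (t : F) : ℕ := Module.finrank (IntermediateField.adjoin W {t}) F

theorem extDegree_inv (t : F) : extDegree W t⁻¹ = extDegree W t := by
  have h : IntermediateField.adjoin W {t⁻¹} = IntermediateField.adjoin W {t} := by
    refine le_antisymm ?_ ?_ <;> rw [IntermediateField.adjoin_simple_le_iff]
    · exact inv_mem (IntermediateField.mem_adjoin_simple_self W t)
    · simpa using inv_mem (IntermediateField.mem_adjoin_simple_self W t⁻¹)
  rw [extDegree, extDegree, h]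

open scoped IntermediateField.algebraAdjoinAdjoin in
-- Dependence and independence over `W(t)` with denominators cleared. The nonzero constant
-- coefficient makes a relation survive reduction at a place where `t` vanishes. The first half
-- gives upper bounds by `[F : W(t)]`, the second gives many independent functions.
theorem exists_relation_and_basis {t : F} (ht : Transcendental W t)
    [FiniteDimensional (IntermediateField.adjoin W {t}) F] :
    (∀ {ι : Type} [Fintype ι] (z : ι → F), extDegree W t < Fintype.card ι →
      ∃ c : ι → W[X], (∃ i, (c i).coeff 0 ≠ 0) ∧ ∑ i, aeval t (c i) * z i = 0) ∧
      ∃ u : Fin (extDegree W t) → F, ∀ c : Fin (extDegree W t) → W[X],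
        ∑ i, aeval t (c i) * u i = 0 → ∀ i, c i = 0 := by
  set L := IntermediateField.adjoin W {t}
  set R := Algebra.adjoin W {t}
  have ht0 : t ≠ 0 := by
    rintro rfl
    exact ht isAlgebraic_zero
  have hR : ∀ r : R, ∃ p : W[X], aeval t p = (r : F) := fun r => by
    have := (Algebra.adjoin_singleton_eq_range_aeval W t).le r.2
    exact this
  refine ⟨fun {ι} _ z hz => ?_, ?_⟩
  · have hli : ¬ LinearIndependent L z := fun h => by
      have : _ ≤ extDegree W t := h.fintype_card_le_finrank
      omega
    rw [← LinearIndependent.iff_fractionRing R L, Fintype.not_linearIndependent_iff] at hli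
    obtain ⟨g, hg, i, hi⟩ := hli
    choose p hp using fun i => hR (g i)
    refine exists_relation_coeff_zero ht0 z p i ?_ ?_
    · intro h0
      apply hi
      have := hp i
      rw [h0, map_zero] at this
      exact Subtype.ext this.symm
    · rw [← hg]
      refine Finset.sum_congr rfl fun i _ => ?_
      rw [hp, Algebra.smul_def]
      rfl
  · let b := Module.finBasis L F
    have hli := b.linearIndependent
    rw [← LinearIndependent.iff_fractionRing R L, Fintype.linearIndependent_iff] at hli
    refine ⟨b, fun c hc i => ?_⟩
    have := hli (fun i => ⟨aeval t (c i), by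
      rw [show R = _ from Algebra.adjoin_singleton_eq_range_aeval W t]; exact ⟨c i, rfl⟩⟩) (by
        rw [← hc]
        refine Finset.sum_congr rfl fun i _ => ?_
        rw [Algebra.smul_def]
        rfl) i
    exact (transcendental_iff.1 ht) _ (congrArg Subtype.val this)

open scoped IntermediateField.algebraAdjoinAdjoin in
-- The transcendence degree of `F` is at most one, so `F` is algebraic over `W(t)`; being finitely
-- generated as a field, it is then finite.
theorem finiteDimensional_adjoin_of_transcendental (hF : IsFunctionFieldOne W F) {t : F}
    (ht : Transcendental W t) : FiniteDimensional (IntermediateField.adjoin W {t}) F := by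
  obtain ⟨s, hs, hfin⟩ := hF
  have : Algebra.EssFiniteType W (IntermediateField.adjoin W {s}) :=
    IntermediateField.essFiniteType_iff.2 (IntermediateField.fg_adjoin_of_finite
      (Set.finite_singleton s))
  have : Algebra.EssFiniteType W F :=
    Algebra.EssFiniteType.comp W (IntermediateField.adjoin W {s}) F
  have : Algebra.IsAlgebraic (Algebra.adjoin W {s}) F :=
    Algebra.IsAlgebraic.trans _ (IntermediateField.adjoin W {s}) _
  have htr : Algebra.trdeg W F ≤ 1 := by
    simpa using Algebra.IsAlgebraic.trdeg_le_cardinalMk W ({s} : Set F)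
  have hind : AlgebraicIndependent W (fun _ : Unit => t) :=
    algebraicIndependent_unique_type_iff.2 ht
  have hbasis := hind.isTranscendenceBasis_of_lift_trdeg_le_of_finite (by simpa using htr)
  have := hbasis.isAlgebraic_field
  rw [Set.range_const] at this
  have : Algebra.EssFiniteType (IntermediateField.adjoin W {t}) F :=
    Algebra.EssFiniteType.of_comp W _ F
  exact Algebra.finite_of_essFiniteType_of_isAlgebraic

end Relations

/-! ### Valuation rings of a function field: discreteness, existence, residue fields -/

section Discrete

variable {W F : Type*} [Field W] [Field F] [Algebra W F]
variable {Γ : Type*} [LinearOrderedCommGroupWithZero Γ]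

theorem aeval_eq_coeff_zero_add (t : F) (p : W[X]) :
    aeval t p = algebraMap W F (p.coeff 0) + t * aeval t p.divX := by
  conv_lhs => rw [← p.divX_mul_X_add]
  rw [map_add, map_mul, aeval_X, aeval_C]
  ring

theorem valuation_constant {v : Valuation F Γ} (hW : ∀ c : W, v (algebraMap W F c) ≤ 1)
    {c : W} (hc : c ≠ 0) : v (algebraMap W F c) = 1 := by
  refine le_antisymm (hW c) ?_
  have h := hW c⁻¹
  rw [map_inv₀, map_inv₀] at h
  exact (inv_le_one₀ (by simpa [zero_lt_iff] using hc)).1 h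

theorem valuation_aeval_le_one {v : Valuation F Γ} (hW : ∀ c : W, v (algebraMap W F c) ≤ 1)
    {t : F} (ht : v t ≤ 1) (p : W[X]) : v (aeval t p) ≤ 1 := by
  rw [aeval_eq_sum_range]
  refine v.map_sum_le fun i _ => ?_
  rw [Algebra.smul_def, map_mul, map_pow]
  exact mul_le_one' (hW _) (pow_le_one' ht _)

/-- Among the terms whose coefficient has nonzero constant term, the one with the largest `v (z i)`
strictly dominates the sum: the terms whose coefficient is divisible by `t` have value at most `v
t`. Hence `v` takes at most `[F : W(t)]` values in the interval `(v t, 1]`. -/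
theorem card_le_of_valuation {v : Valuation F Γ} (hW : ∀ c : W, v (algebraMap W F c) ≤ 1)
    {t : F} (ht : v t < 1) {ι : Type*} [Fintype ι] (z : ι → F) (hz : ∀ i, v t < v (z i))
    (hz1 : ∀ i, v (z i) ≤ 1) (hinj : Function.Injective fun i => v (z i))
    (c : ι → W[X]) (hc : ∃ i, (c i).coeff 0 ≠ 0) : ∑ i, aeval t (c i) * z i ≠ 0 := by
  classical
  intro h
  obtain ⟨i, hi, hmax⟩ := Finset.exists_max_image
    (Finset.univ.filter fun i => (c i).coeff 0 ≠ 0) (fun i => v (z i))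
    (by obtain ⟨i, hi⟩ := hc; exact ⟨i, by simpa using hi⟩)
  simp only [Finset.mem_filter, Finset.mem_univ, true_and] at hi hmax
  have hrest : ∀ p : W[X], v (t * aeval t p) ≤ v t := fun p => by
    rw [map_mul]
    exact mul_le_of_le_one_right' (valuation_aeval_le_one hW ht.le p)
  have hvi : v (aeval t (c i)) = 1 := by
    rw [aeval_eq_coeff_zero_add, v.map_add_eq_of_lt_left, valuation_constant hW hi]
    rw [valuation_constant hW hi]
    exact (hrest _).trans_lt ht
  rw [← Finset.add_sum_erase _ _ (Finset.mem_univ i)] at h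
  have hlt : v (∑ j ∈ Finset.univ.erase i, aeval t (c j) * z j) < v (z i) := by
    refine v.map_sum_lt (ne_of_gt (lt_of_le_of_lt zero_le (hz i))) fun j hj => ?_
    have hj := Finset.ne_of_mem_erase hj
    rw [map_mul]
    by_cases h0 : (c j).coeff 0 = 0
    · refine lt_of_le_of_lt ?_ (hz i)
      rw [aeval_eq_coeff_zero_add, h0, map_zero, zero_add]
      exact (mul_le_of_le_one_right' (hz1 j)).trans (hrest _)
    · refine lt_of_le_of_lt (mul_le_of_le_one_left' (valuation_aeval_le_one hW ht.le _)) ?_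
      exact lt_of_le_of_ne (hmax j h0) fun he => hj (hinj he)
  rw [eq_neg_of_add_eq_zero_right h, Valuation.map_neg, map_mul, hvi, one_mul] at hlt
  exact lt_irrefl _ hlt

theorem notMem_range_of_valuation_lt_one {v : Valuation F Γ}
    (hW : ∀ c : W, v (algebraMap W F c) ≤ 1) {t : F} (ht0 : t ≠ 0) (ht : v t < 1) :
    t ∉ (algebraMap W F).range := by
  rintro ⟨c, rfl⟩
  have : c ≠ 0 := by rintro rfl; simp at ht0
  rw [valuation_constant hW this] at ht
  exact lt_irrefl _ ht

variable [IsAlgClosed W]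

theorem exists_relation_and_basis_of_notMem_range (hF : IsFunctionFieldOne W F) {t : F}
    (ht : t ∉ (algebraMap W F).range) :
    (∀ {ι : Type} [Fintype ι] (z : ι → F), extDegree W t < Fintype.card ι →
      ∃ c : ι → W[X], (∃ i, (c i).coeff 0 ≠ 0) ∧ ∑ i, aeval t (c i) * z i = 0) ∧
      ∃ u : Fin (extDegree W t) → F, ∀ c : Fin (extDegree W t) → W[X],
        ∑ i, aeval t (c i) * u i = 0 → ∀ i, c i = 0 := by
  have htr := transcendental_of_notMem_range ht
  have := finiteDimensional_adjoin_of_transcendental hF htr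
  exact exists_relation_and_basis htr

theorem finite_values (hF : IsFunctionFieldOne W F) {v : Valuation F Γ}
    (hW : ∀ c : W, v (algebraMap W F c) ≤ 1) {t : F} (ht0 : t ≠ 0) (ht : v t < 1) :
    {γ : Γ | v t < γ ∧ γ ≤ 1 ∧ γ ∈ Set.range v}.Finite := by
  obtain ⟨hn, -⟩ := exists_relation_and_basis_of_notMem_range hF
    (notMem_range_of_valuation_lt_one hW ht0 ht)
  by_contra hinf
  obtain ⟨s, hs, hcard⟩ := Set.Infinite.exists_subset_card_eq hinf (extDegree W t + 1)
  let e := (s.equivFin.trans (finCongr hcard)).symm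
  choose z hz using fun i : Fin (extDegree W t + 1) => (hs (e i).2).2.2
  obtain ⟨c, hc, hsum⟩ := hn z (by simp)
  refine card_le_of_valuation hW ht z (fun i => ?_) (fun i => ?_) (fun i j hij => ?_) c hc hsum
  · rw [hz]; exact (hs (e i).2).1
  · rw [hz]; exact (hs (e i).2).2.1
  · simp only [hz] at hij
    exact e.injective (Subtype.ext hij)

/-- Finiteness of the set of values above `v t` gives a largest value `v π < 1`, and also shows that
the powers of `v π` eventually drop below any nonzero value. So every nonzero element of `V` is a
unit times a power of `π`. -/
theorem isDiscreteValuationRing_of_ne_top (hF : IsFunctionFieldOne W F)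
    (V : ValuationSubring F) (hW : ∀ c : W, algebraMap W F c ∈ V) (hV : V ≠ ⊤) :
    IsDiscreteValuationRing V := by
  set v := V.valuation
  have hW' : ∀ c : W, v (algebraMap W F c) ≤ 1 := fun c => (V.valuation_le_one_iff _).2 (hW c)
  obtain ⟨t, ht0, ht⟩ : ∃ t : F, t ≠ 0 ∧ v t < 1 := by
    by_contra! h
    apply hV
    rw [eq_top_iff]
    intro f _
    rcases eq_or_ne f 0 with rfl | hf
    · exact V.zero_mem
    · have := h f⁻¹ (inv_ne_zero hf)
      rw [map_inv₀, one_le_inv₀ (by simpa [zero_lt_iff] using hf)] at this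
      exact (V.valuation_le_one_iff _).1 this
  obtain ⟨γ, ⟨hγ1, π, rfl⟩, hmax⟩ : ∃ γ, (γ < 1 ∧ γ ∈ Set.range v) ∧
      ∀ f, v f < 1 → v f ≤ γ := by
    have hfin : {γ | v t ≤ γ ∧ γ < 1 ∧ γ ∈ Set.range v}.Finite := by
      refine ((finite_values hF hW' ht0 ht).insert (v t)).subset ?_
      rintro γ ⟨h1, h2, h3⟩
      rcases h1.eq_or_lt with h | h
      · exact Or.inl h.symm
      · exact Or.inr ⟨h, h2.le, h3⟩
    obtain ⟨γ, hγ, hmax⟩ := Set.exists_max_image _ id hfin ⟨v t, le_rfl, ht, t, rfl⟩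
    refine ⟨γ, hγ.2, fun f hf => ?_⟩
    rcases le_total (v t) (v f) with h | h
    · exact hmax _ ⟨h, hf, f, rfl⟩
    · exact h.trans hγ.1
  have hπ0 : π ≠ 0 := by
    rintro rfl
    have := hmax t ht
    rw [map_zero, le_zero_iff, map_eq_zero] at this
    exact ht0 this
  have hvπ0 : 0 < v π := by simpa [zero_lt_iff] using hπ0
  have hpow : ∀ f : F, f ≠ 0 → v f ≤ 1 → ∃ n : ℕ, v f = v π ^ n := by
    intro f hf hf1
    have hex : ∃ n : ℕ, v π ^ n ≤ v f := by
      rcases hf1.eq_or_lt with h | h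
      · exact ⟨0, by rw [h, pow_zero]⟩
      · by_contra! hlt
        refine Set.infinite_of_injective_forall_mem (f := fun n : ℕ => v π ^ n) ?_
          (fun n => ?_) (finite_values hF hW' hf h)
        · exact (pow_right_strictAnti₀ hvπ0 hγ1).injective
        · exact ⟨hlt n, pow_le_one' hγ1.le n, π ^ n, map_pow v π n⟩
    classical
    refine ⟨Nat.find hex, le_antisymm ?_ (Nat.find_spec hex)⟩
    rcases hm : Nat.find hex with _ | m
    · simpa using hf1
    · have hlt : v f < v π ^ m := not_le.1 (Nat.find_min hex (m := m) (by omega))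
      have hp : 0 < v π ^ m := pow_pos hvπ0 m
      have := hmax (f / π ^ m) (by
        rw [map_div₀, map_pow]
        exact (div_lt_one₀ hp).2 hlt)
      rw [map_div₀, map_pow, div_le_iff₀ hp] at this
      rwa [pow_succ']
  apply IsDiscreteValuationRing.ofHasUnitMulPowIrreducibleFactorization
  refine ⟨⟨π, (V.valuation_le_one_iff _).1 hγ1.le⟩, ⟨?_, ?_⟩, ?_⟩
  · intro hu
    rw [V.valuation_eq_one_iff] at hu
    exact hγ1.ne hu
  · intro a b hab
    by_contra! hcon
    rw [V.valuation_eq_one_iff, V.valuation_eq_one_iff] at hcon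
    have ha := hmax a (lt_of_le_of_ne (V.valuation_le_one a) hcon.1)
    have hb := lt_of_le_of_ne (V.valuation_le_one b) hcon.2
    have h : v π = v a * v b := by rw [← map_mul]; exact congrArg (fun x : V => v x) hab
    have hb0 : 0 < v (a : F) := lt_of_le_of_ne zero_le fun h0 => by
      rw [← h0, zero_mul] at h
      exact hvπ0.ne' h
    have : v a * v b < v a * 1 := mul_lt_mul_of_pos_left hb hb0
    rw [← h, mul_one] at this
    exact absurd ha (not_le.2 this)
  · intro x hx
    have hx0 : (x : F) ≠ 0 := fun h => hx (Subtype.ext h)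
    obtain ⟨n, hn⟩ := hpow x hx0 (V.valuation_le_one x)
    refine ⟨n, ?_⟩
    have hn' : v ((x : F) / π ^ n) = 1 := by
      rw [map_div₀, map_pow, hn, div_self (pow_pos hvπ0 n).ne']
    have hu : IsUnit (⟨(x : F) / π ^ n, (V.valuation_le_one_iff _).1 hn'.le⟩ : V) :=
      (V.valuation_eq_one_iff _).2 hn'
    refine ⟨hu.unit, Subtype.ext ?_⟩
    change π ^ n * ((x : F) / π ^ n) = x
    field_simp

/-- A nonconstant function has a zero. -/
theorem exists_val_lt_one (hF : IsFunctionFieldOne W F) {f : F}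
    (hf : f ∉ (algebraMap W F).range) : ∃ x : Point W F, x.val f < 1 := by
  have htr := transcendental_of_notMem_range hf
  have hf0 : f ≠ 0 := by
    rintro rfl
    exact hf (zero_mem _)
  let A : Subring F := (Algebra.adjoin W {f}).toSubring
  let fA : A := ⟨f, Algebra.subset_adjoin rfl⟩
  have hI : Ideal.span {fA} ≠ ⊤ := by
    rw [Ne, Ideal.span_singleton_eq_top]
    intro hu
    obtain ⟨b, hb⟩ := isUnit_iff_exists_inv.1 hu
    obtain ⟨p, hp⟩ := (Algebra.adjoin_singleton_eq_range_aeval W f).le b.2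
    have h1 : f * (b : F) = 1 := congrArg Subtype.val hb
    have h2 : aeval f (X * p - 1) = 0 := by
      change aeval f p = (b : F) at hp
      rw [map_sub, map_mul, aeval_X, map_one, hp, h1, sub_self]
    have h3 := congrArg (fun p => coeff p 0) ((transcendental_iff.1 htr) _ h2)
    simp at h3
  -- Chevalley's theorem: the proper ideal `(f)` of `W[f]` is contained in the nonunits of some
  -- valuation ring.
  obtain ⟨V, hAV, hV⟩ := Ideal.image_subset_nonunits_valuationSubring _ hI
  have hfV : f ∈ V.nonunits := hV ⟨fA, Ideal.subset_span rfl, rfl⟩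
  have hW : ∀ c : W, algebraMap W F c ∈ V := fun c =>
    hAV ((Algebra.adjoin W {f}).algebraMap_mem c)
  have hVtop : V ≠ ⊤ := by
    rintro rfl
    rcases (ValuationSubring.mem_nonunits_iff_or _).1 hfV with h | h
    · exact hf0 h
    · exact h (ValuationSubring.mem_top _)
  let x : Point W F := ⟨V, hW, isDiscreteValuationRing_of_ne_top hF V hW hVtop⟩
  refine ⟨x, ?_⟩
  by_contra h
  rw [not_lt] at h
  rcases (ValuationSubring.mem_nonunits_iff_or _).1 hfV with h' | h'
  · exact hf0 h'
  · refine h' ((x.mem_ring_iff).2 ?_)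
    rw [map_inv₀]
    exact inv_le_one_of_one_le₀ h

theorem exists_one_lt_val (hF : IsFunctionFieldOne W F) {f : F}
    (hf : f ∉ (algebraMap W F).range) : ∃ x : Point W F, 1 < x.val f := by
  obtain ⟨x, hx⟩ := exists_val_lt_one hF (f := f⁻¹) (fun ⟨c, hc⟩ => hf ⟨c⁻¹, by
    rw [map_inv₀, hc, inv_inv]⟩)
  refine ⟨x, ?_⟩
  have hf0 : f ≠ 0 := by
    rintro rfl
    exact hf (zero_mem _)
  rwa [map_inv₀, inv_lt_one₀ (by simpa [zero_lt_iff] using hf0)] at hx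

/-- The residue field at a point is the field of constants. -/
theorem Point.exists_val_sub_lt_one (hF : IsFunctionFieldOne W F) (x : Point W F) {f : F}
    (hf : x.val f ≤ 1) : ∃ c : W, x.val (f - algebraMap W F c) < 1 := by
  have hW : ∀ c : W, x.val (algebraMap W F c) ≤ 1 := fun c =>
    x.val_le_one_of_mem (x.algebraMap_mem c)
  obtain ⟨t, ht⟩ := x.exists_val_eq (-1)
  have ht0 := ne_zero_of_val_eq_exp x ht
  have ht1 : x.val t < 1 := by rw [lt_one_iff, ht]
  obtain ⟨hn, -⟩ := exists_relation_and_basis_of_notMem_range hF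
    (notMem_range_of_valuation_lt_one hW ht0 ht1)
  obtain ⟨c, ⟨i, hi⟩, hsum⟩ := hn (fun i : Fin (extDegree W t + 1) => f ^ (i : ℕ)) (by simp)
  -- Reducing the relation among the powers of `f` modulo `t` leaves a nonzero polynomial `P` over
  -- `W` with `P(f)` vanishing at `x`. Since `P` splits, some factor `f - a` vanishes there.
  let P : W[X] := ∑ i : Fin (extDegree W t + 1), C ((c i).coeff 0) * X ^ (i : ℕ)
  have hP0 : P ≠ 0 := by
    intro h0
    have := congrArg (fun p => coeff p i) h0
    simp only [P, finsetSum_coeff, coeff_C_mul, coeff_X_pow, coeff_zero] at this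
    rw [Finset.sum_eq_single i] at this
    · simp at this
      exact hi this
    · intro j _ hj
      rw [if_neg (fun h => hj (Fin.ext h.symm)), mul_zero]
    · simp
  have hP : x.val (aeval f P) < 1 := by
    have : aeval f P = -(t * ∑ i : Fin (extDegree W t + 1), aeval t (c i).divX * f ^ (i : ℕ)) := by
      rw [eq_neg_iff_add_eq_zero, ← hsum, Finset.mul_sum]
      simp only [P, map_sum, map_mul, aeval_C, map_pow, aeval_X]
      rw [← Finset.sum_add_distrib]
      refine Finset.sum_congr rfl fun i _ => ?_
      rw [aeval_eq_coeff_zero_add t (c i)]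
      ring
    rw [this, Valuation.map_neg, map_mul]
    refine lt_of_le_of_lt (mul_le_of_le_one_right' ?_) ht1
    refine Valuation.map_sum_le _ fun i _ => ?_
    rw [map_mul, map_pow]
    exact mul_le_one' (valuation_aeval_le_one hW ht1.le _) (pow_le_one' hf _)
  by_contra! hcon
  have hsplit := IsAlgClosed.splits P
  rw [hsplit.eq_prod_roots, map_mul, aeval_C, map_multiset_prod, map_mul, map_multiset_prod] at hP
  refine absurd hP (not_lt.2 ?_)
  rw [valuation_constant hW (leadingCoeff_ne_zero.2 hP0), one_mul]
  refine Multiset.one_le_prod_of_one_le fun y hy => ?_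
  simp only [Multiset.map_map, Multiset.mem_map, Function.comp] at hy
  obtain ⟨a, -, rfl⟩ := hy
  simpa using hcon a

end Discrete

/-! ### Degrees of divisors -/

section Degree

variable {W F : Type*} [Field W] [Field F] [Algebra W F]

theorem degree_add (A B : Divisor W F) : degree (A + B) = degree A + degree B :=
  Finsupp.sum_add_index' (fun _ => rfl) (fun _ _ _ => rfl)

@[simp]
theorem degree_zero : degree (0 : Divisor W F) = 0 := Finsupp.sum_zero_index

@[simp]
theorem degree_single (x : Point W F) (m : ℤ) : degree (Finsupp.single x m : Divisor W F) = m :=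
  Finsupp.sum_single_index rfl

theorem degree_neg (A : Divisor W F) : degree (-A) = -degree A := by
  have := degree_add A (-A)
  rw [add_neg_cancel, degree_zero] at this
  omega

theorem degree_sub (A B : Divisor W F) : degree (A - B) = degree A - degree B := by
  rw [sub_eq_add_neg, degree_add, degree_neg]
  ring

theorem degree_nsmul (n : ℕ) (A : Divisor W F) : degree (n • A) = n * degree A := by
  induction n with
  | zero => simp
  | succ n ih =>
    rw [add_smul, degree_add, ih, one_smul]
    push_cast
    ring

theorem degree_sum {ι : Type*} (s : Finset ι) (A : ι → Divisor W F) :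
    degree (∑ i ∈ s, A i) = ∑ i ∈ s, degree (A i) := by
  classical
  induction s using Finset.induction_on with
  | empty => simp
  | insert i s hi ih => rw [Finset.sum_insert hi, Finset.sum_insert hi, degree_add, ih]

theorem degree_nonneg {A : Divisor W F} (hA : 0 ≤ A) : 0 ≤ degree A :=
  Finset.sum_nonneg fun x _ => hA x

theorem effective_induction {p : Divisor W F → Prop} (h0 : p 0)
    (hadd : ∀ (E : Divisor W F) (x : Point W F), 0 ≤ E → p E → p (E + Finsupp.single x 1))
    (E : Divisor W F) (hE : 0 ≤ E) : p E := by
  induction hn : (degree E).toNat generalizing E with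
  | zero =>
    have hd := degree_nonneg hE
    have : E = 0 := by
      ext x
      have h1 := (Finset.sum_eq_zero_iff_of_nonneg (s := E.support) (f := E)
        (fun x _ => hE x)).1 (by change degree E = 0; omega)
      by_cases hx : x ∈ E.support
      · exact h1 x hx
      · simpa using hx
    rw [this]
    exact h0
  | succ n ih =>
    obtain ⟨x, hx⟩ : ∃ x, 0 < E x := by
      by_contra! h
      have : E = 0 := by
        ext x
        exact le_antisymm (h x) (hE x)
      rw [this, degree_zero] at hn
      simp at hn
    classical
    have hE' : 0 ≤ E - Finsupp.single x 1 := by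
      intro y
      have := hE y
      rw [Finsupp.sub_apply, Finsupp.single_apply]
      split_ifs with h
      · subst h
        simp only [Finsupp.coe_zero, Pi.zero_apply]
        omega
      · simpa using this
    have := hadd _ x hE' (ih _ hE' (by rw [degree_sub, degree_single]; omega))
    rwa [sub_add_cancel] at this

end Degree

/-! ### Spaces of functions with prescribed poles -/

section FunctionsOn

variable {k K : Type*} [Field k] [Field K] [Algebra k K]

theorem mem_functionsOn {S : Set (Point k K)} {N : Point k K → ℤ} {f : K} :
    f ∈ functionsOn S N ↔ ∀ x ∈ S, x.val f ≤ WithZero.exp (N x) := Iff.rfl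

theorem mem_H0 {E : Divisor k K} {f : K} :
    f ∈ H0 E ↔ ∀ x, x.val f ≤ WithZero.exp (E x) := by
  simp [H0, mem_functionsOn]

theorem functionsOn_mono {S : Set (Point k K)} {N M : Point k K → ℤ} (h : ∀ x ∈ S, N x ≤ M x) :
    functionsOn S N ≤ functionsOn S M := fun _ hf x hx =>
  (hf x hx).trans (WithZero.exp_le_exp.2 (h x hx))

theorem H0_mono {A B : Divisor k K} (h : A ≤ B) : H0 A ≤ H0 B :=
  functionsOn_mono fun x _ => h x

theorem mul_mem_functionsOn {S : Set (Point k K)} {N M : Point k K → ℤ} {f g : K}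
    (hf : f ∈ functionsOn S N) (hg : g ∈ functionsOn S M) : f * g ∈ functionsOn S (N + M) := by
  intro x hx
  rw [map_mul, Pi.add_apply, WithZero.exp_add]
  exact mul_le_mul' (hf x hx) (hg x hx)

theorem mul_mem_H0 {A B : Divisor k K} {f g : K} (hf : f ∈ H0 A) (hg : g ∈ H0 B) :
    f * g ∈ H0 (A + B) := mul_mem_functionsOn hf hg

theorem algebraMap_mem_H0 {A : Divisor k K} (hA : 0 ≤ A) (c : k) : algebraMap k K c ∈ H0 A := by
  rw [mem_H0]
  intro x
  refine (x.val_le_one_of_mem (x.algebraMap_mem c)).trans ?_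
  rw [← WithZero.exp_zero, WithZero.exp_le_exp]
  exact hA x

end FunctionsOn

/-! ### Approximation and the dimension of `𝒪(A + D)/𝒪(A)` -/

section Approximation

variable {W F : Type*} [Field W] [Field F] [Algebra W F] [IsAlgClosed W]

/-- Start from `a / b` with a zero at `P` and a pole at `Q`, and take `(a / b - c)⁻¹`. The constant
`c` must avoid `0` and the value of `a / b` at each point of `S`, which excludes finitely many
elements of the infinite field `W`. -/
theorem exists_separating_pair (S : Finset (Point W F)) {P Q : Point W F} (hPQ : P ≠ Q) :
    ∃ w : F, P.val w = 1 ∧ Q.val w < 1 ∧ ∀ R ∈ S, R.val w ≤ 1 := by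
  obtain ⟨a, haP, haQ⟩ : ∃ a, P.val a ≤ 1 ∧ 1 < Q.val a := by
    by_contra! h
    exact hPQ (Point.ext_val h)
  obtain ⟨b, hbQ, hbP⟩ : ∃ b, Q.val b ≤ 1 ∧ 1 < P.val b := by
    by_contra! h
    exact hPQ (Point.ext_val h).symm
  have hP : P.val (a / b) < 1 := by
    rw [map_div₀, div_lt_one₀ (zero_lt_one.trans hbP)]
    exact haP.trans_lt hbP
  have hQ : 1 < Q.val (a / b) := by
    have hb0 : b ≠ 0 := by rintro rfl; simp at hbP
    rw [map_div₀, one_lt_div₀ (by simpa [zero_lt_iff] using hb0)]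
    exact hbQ.trans_lt haQ
  set w := a / b
  have hbad : (⋃ R ∈ S, {c : W | R.val (w - algebraMap W F c) < 1}).Finite := by
    refine Set.Finite.biUnion S.finite_toSet fun R _ => Set.Subsingleton.finite ?_
    intro c hc d hd
    by_contra hcd
    have h := R.val_algebraMap (sub_ne_zero.2 hcd)
    have h2 : R.val ((w - algebraMap W F d) - (w - algebraMap W F c)) < 1 :=
      (Valuation.map_sub _ _ _).trans_lt (max_lt hd hc)
    rw [sub_sub_sub_cancel_left, ← map_sub, h] at h2
    exact lt_irrefl _ h2
  have : Infinite W := IsAlgClosed.instInfinite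
  obtain ⟨c, hc⟩ := ((hbad.insert 0).infinite_compl).nonempty
  simp only [Set.mem_compl_iff, Set.mem_insert_iff, not_or, Set.mem_iUnion, not_exists,
    Set.mem_ofPred_eq, not_lt] at hc
  obtain ⟨hc0, hc⟩ := hc
  refine ⟨(w - algebraMap W F c)⁻¹, ?_, ?_, fun R hR => ?_⟩
  · rw [map_inv₀, Valuation.map_sub_swap, Valuation.map_sub_eq_of_lt_left, P.val_algebraMap hc0,
      inv_one]
    rwa [P.val_algebraMap hc0]
  · have : Q.val (w - algebraMap W F c) = Q.val w := by
      rw [Valuation.map_sub_eq_of_lt_left]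
      rwa [Q.val_algebraMap hc0]
    rw [map_inv₀, this]
    exact inv_lt_one_of_one_lt₀ hQ
  · rw [map_inv₀]
    exact inv_le_one_of_one_le₀ (hc R hR)

theorem exists_separating (S : Finset (Point W F)) (P : Point W F) :
    ∃ w : F, P.val w = 1 ∧ ∀ Q ∈ S, Q ≠ P → Q.val w < 1 := by
  classical
  have h : ∀ Q : Point W F, ∃ w : F, P.val w = 1 ∧ (Q ≠ P → Q.val w < 1) ∧
      ∀ R ∈ S, R.val w ≤ 1 := by
    intro Q
    by_cases hQ : Q = P
    · exact ⟨1, by simp, fun h => absurd hQ h, fun R _ => by simp⟩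
    · obtain ⟨w, h1, h2, h3⟩ := exists_separating_pair S (Ne.symm hQ)
      exact ⟨w, h1, fun _ => h2, h3⟩
  choose w hwP hwQ hwR using h
  refine ⟨∏ Q ∈ S, w Q, ?_, fun Q hQ hne => ?_⟩
  · rw [map_prod]
    exact Finset.prod_eq_one fun Q _ => hwP Q
  · rw [map_prod, ← Finset.mul_prod_erase _ _ hQ]
    refine lt_of_le_of_lt (mul_le_of_le_one_right' ?_) (hwQ Q hne)
    exact Finset.prod_le_one' fun R _ => hwR R Q hQ

/-- A form of weak approximation. -/
theorem exists_val_eq_and_le (S : Finset (Point W F)) (P : Point W F) (A : Point W F → ℤ) :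
    ∃ f : F, P.val f = WithZero.exp (A P) ∧ ∀ Q ∈ S, Q.val f ≤ WithZero.exp (A Q) := by
  obtain ⟨w, hwP, hw⟩ := exists_separating S P
  obtain ⟨g, hg⟩ := P.exists_val_eq (A P)
  have hg0 := ne_zero_of_val_eq_exp P hg
  choose b hb using fun Q : Point W F => Q.exists_val_eq_exp hg0
  let m := ∑ Q ∈ S, (b Q - A Q).natAbs
  refine ⟨w ^ m * g, by rw [map_mul, map_pow, hwP, one_pow, one_mul, hg], fun Q hQ => ?_⟩
  by_cases hQP : Q = P
  · rw [hQP, map_mul, map_pow, hwP, one_pow, one_mul, hg]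
  · have hm : (b Q - A Q).natAbs ≤ m :=
      Finset.single_le_sum (f := fun Q => (b Q - A Q).natAbs) (fun _ _ => Nat.zero_le _) hQ
    have h1 : Q.val w ^ m ≤ WithZero.exp (-(m : ℤ)) := by
      refine (pow_le_pow_left' (lt_one_iff.1 (hw Q hQ hQP)) m).trans (le_of_eq ?_)
      rw [← WithZero.exp_nsmul]
      simp
    rw [map_mul, map_pow, hb]
    refine (mul_le_mul_left h1 _).trans ?_
    rw [← WithZero.exp_add, WithZero.exp_le_exp]
    omega

/-- Lower half of `dim 𝒪(A + D)/𝒪(A) = deg D`: each point added to `D` brings, by approximation, a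
function attaining the new pole order exactly. -/
theorem exists_independent_modulo (S : Finset (Point W F)) (A : Point W F → ℤ)
    (D : Divisor W F) (hD : 0 ≤ D) (hDS : D.support ⊆ S) :
    ∃ n : ℕ, (n : ℤ) = degree D ∧ ∃ f : Fin n → F, (∀ i, f i ∈ functionsOn (S : Set (Point W F)) (A + ⇑D)) ∧
      ∀ c : Fin n → W, ∑ i, c i • f i ∈ functionsOn (S : Set (Point W F)) A → ∀ i, c i = 0 := by
  revert hDS
  refine effective_induction (p := fun D => D.support ⊆ S → ∃ n : ℕ, (n : ℤ) = degree D ∧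
    ∃ f : Fin n → F, (∀ i, f i ∈ functionsOn (S : Set (Point W F)) (A + ⇑D)) ∧
      ∀ c : Fin n → W, ∑ i, c i • f i ∈ functionsOn (S : Set (Point W F)) A → ∀ i, c i = 0)
    (fun _ => ⟨0, by simp, Fin.elim0, fun i => i.elim0, fun _ _ i => i.elim0⟩)
    (fun D P hD ih hDS => ?_) D hD
  · have hle : ∀ x, D x ≤ (D + Finsupp.single P 1 : Divisor W F) x := fun x => by
      classical
      rw [Finsupp.add_apply, Finsupp.single_apply]
      split_ifs <;> omega
    have hP : (D + Finsupp.single P 1 : Divisor W F) P = D P + 1 := by simp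
    have hPS : P ∈ S := hDS (by rw [Finsupp.mem_support_iff, hP]; have : 0 ≤ D P := hD P; omega)
    obtain ⟨n, hn, f, hf, hind⟩ := ih fun x hx => hDS <| by
      rw [Finsupp.mem_support_iff] at hx ⊢
      have h1 : 0 ≤ D x := hD x
      have := hle x
      omega
    obtain ⟨g, hgP, hg⟩ := exists_val_eq_and_le S P (A + ⇑(D + Finsupp.single P 1 : Divisor W F))
    refine ⟨n + 1, by rw [degree_add, degree_single]; push_cast; rw [hn],
      Fin.snoc f g, fun i => ?_, fun c hc => ?_⟩
    · refine Fin.lastCases ?_ (fun i => ?_) i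
      · rw [Fin.snoc_last]
        exact hg
      · rw [Fin.snoc_castSucc]
        exact functionsOn_mono (fun x _ => by simpa using hle x) (hf i)
    · rw [Fin.sum_univ_castSucc] at hc
      simp only [Fin.snoc_castSucc, Fin.snoc_last] at hc
      have hlast : c (Fin.last n) = 0 := by
        by_contra h0
        have h1 : c (Fin.last n) • g ∈ functionsOn (S : Set (Point W F)) (A + ⇑D) := by
          have h2 : ∑ i : Fin n, c i.castSucc • f i ∈ functionsOn (S : Set (Point W F)) (A + ⇑D) :=
            Submodule.sum_mem _ fun i _ => Submodule.smul_mem _ _ (hf i)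
          have h3 := functionsOn_mono (M := A + ⇑D) (fun x _ => by
            have : 0 ≤ D x := hD x
            simpa using this) hc
          simpa using Submodule.sub_mem _ h3 h2
        have := h1 P hPS
        rw [Algebra.smul_def, map_mul, P.val_algebraMap h0, one_mul, hgP, WithZero.exp_le_exp]
          at this
        simp only [Pi.add_apply] at this
        omega
      rw [hlast, zero_smul, add_zero] at hc
      intro i
      exact Fin.lastCases hlast (hind _ hc) i

/-- Upper half: adding a point `P` to `D` adds at most one dimension, because the residue field is
`W`, so that a constant multiple of one function of the new order cancels the leading term of any
other. -/
theorem exists_span_modulo (hF : IsFunctionFieldOne W F) (S : Set (Point W F))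
    (X : Submodule W F) (A : Point W F → ℤ) (D : Divisor W F) (hD : 0 ≤ D) :
    ∃ T : Finset F, (T.card : ℤ) ≤ degree D ∧
      (∀ f ∈ T, f ∈ X ⊓ functionsOn S (A + ⇑D)) ∧
      X ⊓ functionsOn S (A + ⇑D) ≤ X ⊓ functionsOn S A ⊔ Submodule.span W T := by
  classical
  refine effective_induction (p := fun D => ∃ T : Finset F, (T.card : ℤ) ≤ degree D ∧
    (∀ f ∈ T, f ∈ X ⊓ functionsOn S (A + ⇑D)) ∧
      X ⊓ functionsOn S (A + ⇑D) ≤ X ⊓ functionsOn S A ⊔ Submodule.span W T)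
    ⟨∅, by simp, by simp, by simp⟩ (fun D P hD ih => ?_) D hD
  · obtain ⟨T, hT, hTX, hspan⟩ := ih
    have hle : ∀ x, D x ≤ (D + Finsupp.single P 1 : Divisor W F) x := fun x => by
      rw [Finsupp.add_apply, Finsupp.single_apply]
      split_ifs <;> omega
    have hP : (D + Finsupp.single P 1 : Divisor W F) P = D P + 1 := by simp
    have hne : ∀ x, x ≠ P → (D + Finsupp.single P 1 : Divisor W F) x = D x := fun x hx => by
      simp [Finsupp.single_eq_of_ne hx]
    have hTX' : ∀ f ∈ T, f ∈ X ⊓ functionsOn S (A + ⇑(D + Finsupp.single P 1 : Divisor W F)) :=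
      fun f hf => ⟨(hTX f hf).1, functionsOn_mono (fun x _ => by simpa using hle x) (hTX f hf).2⟩
    by_cases hex : ∃ g ∈ X ⊓ functionsOn S (A + ⇑(D + Finsupp.single P 1 : Divisor W F)),
        P.val g = WithZero.exp (A P + D P + 1) ∧ P ∈ S
    · obtain ⟨g, hg, hgP, hPS⟩ := hex
      refine ⟨insert g T, ?_, ?_, fun f hf => ?_⟩
      · rw [degree_add, degree_single]
        have := Finset.card_insert_le g T
        omega
      · intro f hf
        rcases Finset.mem_insert.1 hf with rfl | hf
        · exact hg
        · exact hTX' f hf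
      · have hg0 := ne_zero_of_val_eq_exp P hgP
        obtain ⟨c, hc⟩ := P.exists_val_sub_lt_one hF (f := f / g) (by
          have := hf.2 P hPS
          rw [Pi.add_apply, hP, ← add_assoc, ← hgP] at this
          rw [map_div₀]
          exact div_le_one_of_le₀ this zero_le)
        have hfc : f - c • g ∈ X ⊓ functionsOn S (A + ⇑D) := by
          have h1 := Submodule.sub_mem _ hf (Submodule.smul_mem _ c hg)
          refine ⟨h1.1, fun x hx => ?_⟩
          by_cases hxP : x = P
          · subst hxP
            have : f - c • g = (f / g - algebraMap W F c) * g := by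
              rw [Algebra.smul_def]
              field_simp
            rw [this, map_mul, hgP]
            refine (mul_le_mul_left (lt_one_iff.1 hc) _).trans ?_
            rw [← WithZero.exp_add, WithZero.exp_le_exp, Pi.add_apply]
            omega
          · have := h1.2 x hx
            rwa [Pi.add_apply, hne x hxP] at this
        have h2 := hspan hfc
        have h3 : X ⊓ functionsOn S A ⊔ Submodule.span W (T : Set F) ≤
            X ⊓ functionsOn S A ⊔ Submodule.span W (insert g T : Finset F) :=
          sup_le_sup_left (Submodule.span_mono (by simp)) _
        have h4 : c • g ∈ X ⊓ functionsOn S A ⊔ Submodule.span W (insert g T : Finset F) :=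
          Submodule.mem_sup_right (Submodule.smul_mem _ _ (Submodule.subset_span (by simp)))
        simpa using Submodule.add_mem _ (h3 h2) h4
    · push Not at hex
      refine ⟨T, by rw [degree_add, degree_single]; omega, hTX', fun f hf => hspan ⟨hf.1, ?_⟩⟩
      intro x hx
      have hfx := hf.2 x hx
      by_cases hxP : x = P
      · subst hxP
        have : x.val f ≠ WithZero.exp (A x + D x + 1) := fun h => hex f hf h hx
        rw [Pi.add_apply, hP, ← add_assoc] at hfx
        have := lt_exp_iff.1 (lt_of_le_of_ne hfx this)
        rwa [add_sub_cancel_right] at this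
      · rwa [Pi.add_apply, hne x hxP] at hfx

end Approximation

/-! ### Principal divisors have degree zero; Riemann's theorem -/

section RiemannRoch

variable {W F : Type*} [Field W] [Field F] [Algebra W F]

theorem Point.val_algebraMap_le_one (x : Point W F) (c : W) : x.val (algebraMap W F c) ≤ 1 :=
  x.val_le_one_of_mem (x.algebraMap_mem c)

theorem notMem_range_inv {f : F} (hf : f ∉ (algebraMap W F).range) :
    f⁻¹ ∉ (algebraMap W F).range := fun ⟨c, hc⟩ => hf ⟨c⁻¹, by rw [map_inv₀, hc, inv_inv]⟩

theorem IsDivisorOf.mem_H0 {E : Divisor W F} {f : F} (h : IsDivisorOf E f) : f ∈ H0 (-E) :=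
  Shtuka.mem_H0.2 fun x => (h.2 x).le

theorem IsDivisorOf.inv {E : Divisor W F} {f : F} (h : IsDivisorOf E f) :
    IsDivisorOf (-E) f⁻¹ :=
  ⟨inv_ne_zero h.1, fun x => by rw [map_inv₀, h.2, ← WithZero.exp_neg, Finsupp.neg_apply]⟩

theorem IsDivisorOf.mul_mem_H0_iff {E A : Divisor W F} {f g : F} (h : IsDivisorOf E f) :
    f * g ∈ H0 A ↔ g ∈ H0 (A + E) := by
  constructor
  · intro hg
    have := mul_mem_H0 hg h.inv.mem_H0
    rwa [mul_comm f, mul_assoc, mul_inv_cancel₀ h.1, mul_one, neg_neg] at this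
  · intro hg
    have := mul_mem_H0 h.mem_H0 hg
    rwa [neg_add_cancel_comm_assoc] at this

theorem finrank_H0_add_of_isDivisorOf {E : Divisor W F} {f : F}
    (h : IsDivisorOf E f) (A : Divisor W F) :
    Module.finrank W (H0 (A + E)) = Module.finrank W (H0 A) := by
  let e : F ≃ₗ[W] F := LinearEquiv.ofBijective (LinearMap.mulLeft W f)
    ⟨mul_right_injective₀ h.1, mul_left_surjective₀ h.1⟩
  have : H0 A = (H0 (A + E)).map (e : F →ₗ[W] F) := by
    ext g
    constructor
    · intro hg
      refine ⟨f⁻¹ * g, h.mul_mem_H0_iff.1 ?_, mul_inv_cancel_left₀ h.1 g⟩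
      rwa [mul_inv_cancel_left₀ h.1]
    · rintro ⟨g, hg, rfl⟩
      exact h.mul_mem_H0_iff.2 hg
  rw [this]
  exact (e.finrank_map_eq _).symm

variable [IsAlgClosed W]

/-- Regular functions independent modulo `𝒪(-D)` remain independent over `W(t)`: since `t ∈ 𝒪(-D)`,
the constant terms of a relation would be a dependence modulo `𝒪(-D)`. -/
theorem degree_le_extDegree (hF : IsFunctionFieldOne W F) {t : F}
    (ht : t ∉ (algebraMap W F).range) {D : Divisor W F} (hD : 0 ≤ D)
    (h : ∀ x ∈ D.support, x.val t ≤ WithZero.exp (-(D x))) : degree D ≤ extDegree W t := by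
  obtain ⟨hrel, -⟩ := exists_relation_and_basis_of_notMem_range hF ht
  obtain ⟨n, hn, f, hf, hind⟩ := exists_independent_modulo D.support (-⇑D) D hD le_rfl
  rw [neg_add_cancel] at hf
  by_contra hlt
  obtain ⟨c, ⟨i, hi⟩, hc⟩ := hrel f (by rw [Fintype.card_fin]; omega)
  refine hi (hind (fun i => (c i).coeff 0) ?_ i)
  have : ∑ i, (c i).coeff 0 • f i = -(t * ∑ i, aeval t (c i).divX * f i) := by
    rw [eq_neg_iff_add_eq_zero, ← hc, Finset.mul_sum, ← Finset.sum_add_distrib]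
    refine Finset.sum_congr rfl fun i _ => ?_
    rw [aeval_eq_coeff_zero_add t (c i), Algebra.smul_def]
    ring
  rw [this]
  refine Submodule.neg_mem _ fun x hx => ?_
  have hx1 : x.val t ≤ 1 := (h x hx).trans (by
    rw [← WithZero.exp_zero, WithZero.exp_le_exp]
    have : 0 ≤ D x := hD x
    omega)
  rw [map_mul]
  refine (mul_le_of_le_one_right' (x.val.map_sum_le fun i _ => ?_)).trans (h x hx)
  rw [map_mul]
  exact mul_le_one' (valuation_aeval_le_one x.val_algebraMap_le_one hx1 _) (hf i x hx)

theorem finite_zeros (hF : IsFunctionFieldOne W F) {t : F} (ht : t ∉ (algebraMap W F).range) :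
    {x : Point W F | x.val t < 1}.Finite := by
  classical
  by_contra hinf
  obtain ⟨s, hs, hcard⟩ := Set.Infinite.exists_subset_card_eq hinf (extDegree W t + 1)
  let D : Divisor W F := ∑ x ∈ s, Finsupp.single x 1
  have hDx : ∀ x, D x = if x ∈ s then 1 else 0 := fun x => by
    simp [D, Finsupp.finsetSum_apply, Finsupp.single_apply]
  have := degree_le_extDegree hF ht (D := D) (fun x => by
    rw [hDx]
    split_ifs <;> simp) (fun x hx => by
    rw [Finsupp.mem_support_iff, hDx] at hx
    have hxs : x ∈ s := by by_contra h; simp [h] at hx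
    rw [hDx, if_pos hxs]
    exact lt_one_iff.1 (hs hxs))
  rw [degree_sum] at this
  simp only [degree_single, Finset.sum_const, hcard] at this
  simp at this

theorem exists_isDivisorOf (hF : IsFunctionFieldOne W F) {f : F} (hf : f ≠ 0) :
    ∃ E : Divisor W F, IsDivisorOf E f := by
  have hfin : (Function.support fun x : Point W F => -WithZero.log (x.val f)).Finite := by
    by_cases hc : f ∈ (algebraMap W F).range
    · obtain ⟨c, rfl⟩ := hc
      have hc0 : c ≠ 0 := by rintro rfl; simp at hf
      simp [Function.support, Point.val_algebraMap _ hc0]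
    · refine ((finite_zeros hF hc).union (finite_zeros hF (notMem_range_inv hc))).subset ?_
      intro x hx
      by_contra hcon
      simp only [Set.mem_union, Set.mem_ofPred_eq, not_or, not_lt, map_inv₀] at hcon
      refine hx ?_
      have : x.val f = 1 := le_antisymm
        ((one_le_inv₀ (zero_lt_iff.2 (x.val_ne_zero hf))).1 hcon.2) hcon.1
      simp [this]
  refine ⟨Finsupp.ofSupportFinite _ hfin, hf, fun x => ?_⟩
  rw [Finsupp.ofSupportFinite_coe, neg_neg, WithZero.exp_log (x.val_ne_zero hf)]

theorem mem_H0_zero_iff (hF : IsFunctionFieldOne W F) {f : F} :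
    f ∈ H0 (0 : Divisor W F) ↔ f ∈ (algebraMap W F).range := by
  constructor
  · intro hf
    by_contra hc
    obtain ⟨x, hx⟩ := exists_one_lt_val hF hc
    exact absurd (mem_H0.1 hf x) (not_le.2 hx)
  · rintro ⟨c, rfl⟩
    exact algebraMap_mem_H0 le_rfl c

theorem H0_zero (hF : IsFunctionFieldOne W F) :
    H0 (0 : Divisor W F) = Submodule.span W {(1 : F)} := by
  ext f
  rw [mem_H0_zero_iff hF, Submodule.mem_span_singleton]
  simp [Algebra.smul_def]

theorem finrank_H0_zero (hF : IsFunctionFieldOne W F) :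
    Module.finrank W (H0 (0 : Divisor W F)) = 1 := by
  rw [H0_zero hF, finrank_span_singleton one_ne_zero]

theorem exists_H0_le_sup (hF : IsFunctionFieldOne W F) {A B : Divisor W F} (h : A ≤ B) :
    ∃ T : Finset F, (T.card : ℤ) ≤ degree B - degree A ∧
      H0 B ≤ H0 A ⊔ Submodule.span W T := by
  obtain ⟨T, hT, -, hspan⟩ := exists_span_modulo hF Set.univ ⊤ A (B - A) (sub_nonneg.2 h)
  rw [degree_sub] at hT
  refine ⟨T, hT, ?_⟩
  rwa [top_inf_eq, top_inf_eq, ← Finsupp.coe_add, add_sub_cancel] at hspan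

theorem finiteDimensional_H0 (hF : IsFunctionFieldOne W F) (A : Divisor W F) :
    FiniteDimensional W (H0 A) := by
  obtain ⟨T, -, hT⟩ := exists_H0_le_sup hF (A := 0) (B := A ⊔ 0) le_sup_right
  have h : H0 A ≤ Submodule.span W {(1 : F)} ⊔ Submodule.span W T := by
    rw [← H0_zero hF]
    exact (H0_mono le_sup_left).trans hT
  exact Submodule.finiteDimensional_of_le h

theorem finrank_H0_le (hF : IsFunctionFieldOne W F) {A B : Divisor W F} (h : A ≤ B) :
    (Module.finrank W (H0 B) : ℤ) ≤ Module.finrank W (H0 A) + (degree B - degree A) := by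
  have := finiteDimensional_H0 hF
  obtain ⟨T, hT, hspan⟩ := exists_H0_le_sup hF h
  have h1 := Submodule.finrank_mono hspan
  have h2 := Submodule.finrank_add_le_finrank_add_finrank (H0 A) (Submodule.span W (T : Set F))
  have h3 : Module.finrank W (Submodule.span W (T : Set F)) ≤ T.card :=
    finrank_span_finset_le_card T
  omega

/-- The functions `f ^ j * u i` grow as fast as `extDegree W f` allows. -/
theorem exists_le_finrank_H0 (hF : IsFunctionFieldOne W F) {f : F}
    (hf : f ∉ (algebraMap W F).range) {X : Divisor W F} (hX : 0 ≤ X) (hfX : f ∈ H0 X) :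
    ∃ C : Divisor W F, 0 ≤ C ∧ ∀ l : ℕ,
      extDegree W f * (l + 1) ≤ Module.finrank W (H0 (l • X + C)) := by
  obtain ⟨-, u, hu⟩ := exists_relation_and_basis_of_notMem_range hF hf
  have hu0 : ∀ i, u i ≠ 0 := by
    classical
    intro i hi
    have := hu (fun j => if j = i then 1 else 0) (by
      refine Finset.sum_eq_zero fun j _ => ?_
      split_ifs with h
      · rw [h, hi, mul_zero]
      · simp) i
    simp at this
  choose E hE using fun i => exists_isDivisorOf hF (hu0 i)
  let C : Divisor W F := ∑ i, (-E i ⊔ 0)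
  have hC0 : ∀ i, (0 : Divisor W F) ≤ -E i ⊔ 0 := fun i => le_sup_right
  have huC : ∀ i, u i ∈ H0 C := fun i => H0_mono (le_sup_left.trans
    (Finset.single_le_sum (fun i _ => hC0 i) (Finset.mem_univ i))) (hE i).mem_H0
  refine ⟨C, Finset.sum_nonneg fun i _ => hC0 i, fun l => ?_⟩
  have hpow : ∀ j : ℕ, f ^ j ∈ H0 (j • X) := by
    intro j
    induction j with
    | zero => simpa using algebraMap_mem_H0 (A := (0 : Divisor W F)) le_rfl (1 : W)
    | succ j ih =>
      rw [pow_succ, succ_nsmul]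
      exact mul_mem_H0 ih hfX
  have hmem : ∀ p : Fin (extDegree W f) × Fin (l + 1),
      f ^ (p.2 : ℕ) * u p.1 ∈ H0 (l • X + C) := fun p =>
    H0_mono (add_le_add_left (nsmul_le_nsmul_left hX (Nat.lt_succ_iff.1 p.2.2)) C)
      (mul_mem_H0 (hpow _) (huC p.1))
  have := finiteDimensional_H0 hF (l • X + C)
  let b : Fin (extDegree W f) × Fin (l + 1) → H0 (l • X + C) := fun p => ⟨_, hmem p⟩
  have hb : LinearIndependent W b := by
    rw [Fintype.linearIndependent_iff]
    intro c hc
    have hc' : ∑ i, aeval f (∑ j : Fin (l + 1),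
        Polynomial.C (c (i, j)) * Polynomial.X ^ (j : ℕ)) * u i = 0 := by
      have := congrArg Subtype.val hc
      simp only [b, Submodule.coe_sum, Submodule.coe_smul, ZeroMemClass.coe_zero,
        Fintype.sum_prod_type] at this
      rw [← this]
      refine Finset.sum_congr rfl fun i _ => ?_
      rw [map_sum, Finset.sum_mul]
      refine Finset.sum_congr rfl fun j _ => ?_
      rw [map_mul, aeval_C, map_pow, aeval_X, Algebra.smul_def, mul_assoc]
    rintro ⟨i, j⟩
    have := congrArg (fun p => coeff p j) (hu _ hc' i)
    simp only [finsetSum_coeff, coeff_C_mul, coeff_X_pow, coeff_zero] at this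
    rw [Finset.sum_eq_single j] at this
    · simpa using this
    · intro m _ hm
      rw [if_neg (fun h => hm (Fin.ext h.symm)), mul_zero]
    · simp
  have := hb.fintype_card_le_finrank
  simpa using this

/-- One inequality is the bound on zeros, applied to `f⁻¹`. For the other, `h⁰(lX + C)` is at least
`[F : W(f)] (l + 1)` and at most `l deg X + deg C + 1`; compare for large `l`. -/
theorem degree_poles (hF : IsFunctionFieldOne W F) {f : F}
    (hf : f ∉ (algebraMap W F).range) {E : Divisor W F} (hE : IsDivisorOf E f) :
    degree (-E ⊔ 0) = extDegree W f := by
  have hX : 0 ≤ -E ⊔ 0 := le_sup_right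
  set X := -E ⊔ 0
  refine le_antisymm ?_ ?_
  · rw [← extDegree_inv]
    refine degree_le_extDegree hF (notMem_range_inv hf) hX fun x hx => ?_
    have hXx : X x = max (-E x) 0 := Finsupp.sup_apply _ _ _
    have : X x ≠ 0 := Finsupp.mem_support_iff.1 hx
    have : -X x = E x := by omega
    rw [map_inv₀, hE.2, ← WithZero.exp_neg, neg_neg, this]
  · obtain ⟨C, hC, h⟩ := exists_le_finrank_H0 hF hf hX (H0_mono le_sup_left hE.mem_H0)
    by_contra! hlt
    have h1 : ∀ l : ℕ, (extDegree W f : ℤ) * (l + 1) ≤ l * degree X + degree C + 1 := by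
      intro l
      have h2 := h l
      have h3 := finrank_H0_le hF (A := 0) (B := l • X + C)
        (add_nonneg (nsmul_nonneg hX l) hC)
      rw [finrank_H0_zero hF, degree_add, degree_nsmul, degree_zero] at h3
      zify at h2
      push_cast at h3
      linarith
    -- If `deg X < [F : W(f)]`, the value `l = deg C + 1` is already large enough for a
    -- contradiction.
    have h4 := h1 (degree C + 1).toNat
    have h5 : ((degree C + 1).toNat : ℤ) = degree C + 1 :=
      Int.toNat_of_nonneg (by have := degree_nonneg hC; omega)
    rw [h5] at h4
    have hC0 := degree_nonneg hC
    have h6 : (degree C + 1) * (degree X + 1) ≤ (degree C + 1) * extDegree W f :=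
      mul_le_mul_of_nonneg_left (by omega) (by omega)
    have h7 := degree_nonneg hX
    nlinarith

theorem degree_eq_zero_of_isDivisorOf (hF : IsFunctionFieldOne W F) {f : F} {E : Divisor W F}
    (hE : IsDivisorOf E f) : degree E = 0 := by
  by_cases hc : f ∈ (algebraMap W F).range
  · obtain ⟨c, rfl⟩ := hc
    have hc0 : c ≠ 0 := by rintro rfl; exact hE.1 (map_zero _)
    have : E = 0 := by
      ext x
      have := hE.2 x
      rw [x.val_algebraMap hc0, eq_comm, WithZero.exp_eq_one] at this
      simpa using this
    rw [this, degree_zero]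
  · have h1 := degree_poles hF hc hE
    have h2 := degree_poles hF (notMem_range_inv hc) hE.inv
    rw [extDegree_inv, ← h1] at h2
    have h3 : E = (- -E ⊔ 0) - (-E ⊔ 0) := by
      ext x
      simp only [Finsupp.sub_apply, Finsupp.sup_apply, Finsupp.neg_apply, Finsupp.zero_apply,
        neg_neg]
      omega
    rw [h3, degree_sub, h2, sub_self]

theorem H0_eq_bot_of_degree_neg (hF : IsFunctionFieldOne W F) {A : Divisor W F}
    (hA : degree A < 0) : H0 A = ⊥ := by
  rw [eq_bot_iff]
  intro f hf
  by_contra hf0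
  obtain ⟨E, hE⟩ := exists_isDivisorOf hF hf0
  have h : 0 ≤ A + E := by
    intro x
    have := mem_H0.1 hf x
    rw [hE.2, WithZero.exp_le_exp] at this
    rw [Finsupp.add_apply, Finsupp.zero_apply]
    omega
  have := degree_nonneg h
  rw [degree_add, degree_eq_zero_of_isDivisorOf hF hE] at this
  omega

/-- Riemann's theorem: the genus is finite. -/
theorem bddAbove_genus (hF : IsFunctionFieldOne W F) : BddAbove (Set.range fun A : Divisor W F =>
    degree A + 1 - (Module.finrank W (H0 A) : ℤ)) := by
  obtain ⟨f, hf⟩ : ∃ f : F, f ∉ (algebraMap W F).range := by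
    obtain ⟨t, ht, -⟩ := hF
    exact ⟨t, fun ⟨c, hc⟩ => ht (hc ▸ isAlgebraic_algebraMap c)⟩
  have hf0 : f ≠ 0 := by
    rintro rfl
    exact hf (zero_mem _)
  obtain ⟨E, hE⟩ := exists_isDivisorOf hF hf0
  have hdeg := degree_poles hF hf hE
  have hX : 0 ≤ -E ⊔ 0 := le_sup_right
  have hfX : f ∈ H0 (-E ⊔ 0) := H0_mono le_sup_left hE.mem_H0
  set X := -E ⊔ 0
  have hn : 0 < extDegree W f := by
    have := finiteDimensional_adjoin_of_transcendental hF (transcendental_of_notMem_range hf)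
    exact Module.finrank_pos
  obtain ⟨C, hC, hbound⟩ := exists_le_finrank_H0 hF hf hX hfX
  refine ⟨degree C + 1, ?_⟩
  rintro _ ⟨A, rfl⟩
  have hB : 0 ≤ A ⊔ 0 := le_sup_right
  set B := A ⊔ 0
  have hdB := degree_nonneg hB
  -- With this `l`, `h⁰(lX + C) ≥ l + 1 > deg B`, so `lX + C - B` has a nonzero section `z`. Up to
  -- the divisor of `z`, `A` lies below `lX + C`, and `deg - h⁰` does not decrease when a divisor is
  -- enlarged.
  let l := (degree B).toNat
  have hl : (l : ℤ) = degree B := Int.toNat_of_nonneg hdB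
  have hh := hbound l
  have h1 := finrank_H0_le hF (A := l • X + C - B) (B := l • X + C) (sub_le_self _ hB)
  rw [degree_sub, sub_sub_cancel] at h1
  have hpos : 0 < Module.finrank W (H0 (l • X + C - B)) := by
    have : (l + 1 : ℤ) ≤ extDegree W f * (l + 1) := by
      have : (1 : ℤ) ≤ extDegree W f := by exact_mod_cast hn
      nlinarith
    zify at hh ⊢
    omega
  have hfd := finiteDimensional_H0 hF (l • X + C - B)
  obtain ⟨z, hz⟩ := (Module.finrank_pos_iff_exists_ne_zero (R := W)).1 hpos
  have hz0 : (z : F) ≠ 0 := fun h => hz (Subtype.ext h)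
  obtain ⟨Z, hZ⟩ := exists_isDivisorOf hF hz0
  have hAB : A ≤ B := le_sup_left
  clear_value B
  have hBZ : A ≤ l • X + C + Z := by
    refine hAB.trans fun x => ?_
    have := mem_H0.1 z.2 x
    rw [hZ.2, WithZero.exp_le_exp] at this
    simp only [Finsupp.sub_apply, Finsupp.add_apply] at this ⊢
    omega
  have h2 := finrank_H0_le hF hBZ
  rw [finrank_H0_add_of_isDivisorOf hZ, degree_add, degree_eq_zero_of_isDivisorOf hF hZ,
    degree_add, degree_nsmul, hdeg] at h2
  change degree A + 1 - (Module.finrank W (H0 A) : ℤ) ≤ _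
  zify at hh
  nlinarith

theorem le_genus (hF : IsFunctionFieldOne W F) (A : Divisor W F) :
    degree A + 1 - (Module.finrank W (H0 A) : ℤ) ≤ genus W F :=
  le_csSup (bddAbove_genus hF) ⟨A, rfl⟩

theorem genus_nonneg (hF : IsFunctionFieldOne W F) : 0 ≤ genus W F := by
  simpa [finrank_H0_zero hF] using le_genus hF 0

theorem exists_eq_genus (hF : IsFunctionFieldOne W F) :
    ∃ A : Divisor W F, degree A + 1 - (Module.finrank W (H0 A) : ℤ) = genus W F :=
  Int.csSup_mem (Set.range_nonempty _) (bddAbove_genus hF)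

end RiemannRoch

/-! ### First cohomology and Riemann-Roch in large degree -/

section RiemannRoch

variable {W F : Type*} [Field W] [Field F] [Algebra W F] [IsAlgClosed W]

/-- `F` modulo this subspace computes the first cohomology of `𝒪(A)`. -/
def localSum (P : Point W F) (A : Divisor W F) : Submodule W F :=
  functionsOn {P} A ⊔ functionsOn {P}ᶜ A

/-- This is `h¹(𝒪) ≤ g`. For `D = mP` with `m` bounding the poles of the `v i` at `P`, the `v i`
together with `H⁰(D)` map to the polar parts at `P`, a space of dimension at most `m`, and the
kernel consists of constants. So `n + h⁰(D) ≤ m + 1`, while `h⁰(D) ≥ m + 1 - g`. -/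
theorem card_le_genus (hF : IsFunctionFieldOne W F) (P : Point W F) {n : ℕ} (v : Fin n → F)
    (hv : ∀ c : Fin n → W, ∑ i, c i • v i ∈ localSum P 0 → ∀ i, c i = 0) :
    (n : ℤ) ≤ genus W F := by
  have hv0 : ∀ i, v i ≠ 0 := by
    classical
    intro i hi
    have := hv (fun j => if j = i then 1 else 0) (by simp [hi]) i
    simp at this
  choose b hb using fun i => P.exists_val_eq_exp (hv0 i)
  let m := ∑ i, (b i).natAbs
  let D : Divisor W F := m • Finsupp.single P 1
  have hD : 0 ≤ D := nsmul_nonneg (Finsupp.single_nonneg.2 zero_le_one) _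
  have hdeg : degree D = m := by simp [D]
  have hDP : D P = m := by simp [D]
  have hvD : ∀ i, v i ∈ functionsOn {P} D := by
    rintro i x rfl
    rw [hb, WithZero.exp_le_exp, hDP]
    have : (b i).natAbs ≤ m :=
      Finset.single_le_sum (f := fun i => (b i).natAbs) (fun _ _ => Nat.zero_le _)
        (Finset.mem_univ i)
    omega
  let U : Submodule W F := functionsOn {P} ⇑(0 : Divisor W F)
  have hH : ∀ h ∈ H0 D, h ∈ functionsOn {P}ᶜ ⇑(0 : Divisor W F) := by
    intro h hh x hx
    have := mem_H0.1 hh x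
    rwa [show D x = 0 by simp [D, Finsupp.single_eq_of_ne hx]] at this
  obtain ⟨T, hT, -, hspan⟩ := exists_span_modulo hF {P} ⊤ ⇑(0 : Divisor W F) D hD
  rw [top_inf_eq, top_inf_eq, ← Finsupp.coe_add, zero_add] at hspan
  rw [hdeg] at hT
  have := finiteDimensional_H0 hF D
  let φ : (Fin n → W) × H0 D →ₗ[W] F ⧸ U :=
    U.mkQ ∘ₗ (LinearMap.coprod (Fintype.linearCombination W v) (H0 D).subtype)
  have hφ : ∀ p, φ p = U.mkQ (∑ i, p.1 i • v i + (p.2 : F)) := fun p => by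
    simp [φ, Fintype.linearCombination_apply]
  have hrange : Module.finrank W (LinearMap.range φ) ≤ m := by
    classical
    have hle : LinearMap.range φ ≤ Submodule.span W (T.image U.mkQ : Set (F ⧸ U)) := by
      rintro _ ⟨p, rfl⟩
      rw [hφ]
      have hmem : ∑ i, p.1 i • v i + (p.2 : F) ∈ functionsOn {P} ⇑D :=
        Submodule.add_mem _ (Submodule.sum_mem _ fun i _ => Submodule.smul_mem _ _ (hvD i))
          (fun x _ => mem_H0.1 p.2.2 x)
      obtain ⟨u, hu, s, hs, hus⟩ := Submodule.mem_sup.1 (hspan hmem)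
      rw [← hus, map_add, show U.mkQ u = 0 from (Submodule.Quotient.mk_eq_zero _).2 hu, zero_add,
        Finset.coe_image, ← Submodule.map_span]
      exact ⟨s, hs, rfl⟩
    refine (Submodule.finrank_mono hle).trans ((finrank_span_finset_le_card _).trans ?_)
    have := Finset.card_image_le (s := T) (f := U.mkQ)
    omega
  have hker : Module.finrank W (LinearMap.ker φ) ≤ 1 := by
    have hle : LinearMap.ker φ ≤ Submodule.span W
        {((0 : Fin n → W), (⟨1, by simpa using algebraMap_mem_H0 hD (1 : W)⟩ : H0 D))} := by
      rintro ⟨c, h⟩ hp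
      rw [LinearMap.mem_ker, hφ] at hp
      have hp : ∑ i, c i • v i + (h : F) ∈ U := (Submodule.Quotient.mk_eq_zero _).1 hp
      have hc : ∀ i, c i = 0 := by
        refine hv c ?_
        have := Submodule.sub_mem (localSum P 0) (Submodule.mem_sup_left hp)
          (Submodule.mem_sup_right (hH h h.2))
        simpa using this
      have hc0 : c = 0 := funext hc
      subst hc0
      have h0 : (h : F) ∈ H0 (0 : Divisor W F) := by
        rw [mem_H0]
        intro x
        by_cases hx : x = P
        · exact (by simpa using hp : (h : F) ∈ U) x hx
        · exact hH h h.2 x hx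
      obtain ⟨a, ha⟩ := (mem_H0_zero_iff hF).1 h0
      rw [Submodule.mem_span_singleton]
      exact ⟨a, Prod.ext (by simp) (Subtype.ext (by simp [← ha, Algebra.smul_def]))⟩
    exact (Submodule.finrank_mono hle).trans ((finrank_span_le_card _).trans (by simp))
  have hrk := LinearMap.finrank_range_add_finrank_ker φ
  rw [Module.finrank_prod, Module.finrank_fin_fun] at hrk
  have := le_genus hF D
  rw [hdeg] at this
  omega

theorem finiteDimensional_quotient_localSum (hF : IsFunctionFieldOne W F) (P : Point W F) :
    FiniteDimensional W (F ⧸ localSum P 0) ∧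
      (Module.finrank W (F ⧸ localSum P 0) : ℤ) ≤ genus W F := by
  have hg : ((genus W F).toNat : ℤ) = genus W F := Int.toNat_of_nonneg (genus_nonneg hF)
  have hrank : Module.rank W (F ⧸ localSum P 0) ≤ (genus W F).toNat := by
    refine rank_le fun s hs => ?_
    choose v hv using fun i => (localSum P 0).mkQ_surjective (s.equivFin.symm i).1
    have := card_le_genus hF P v (fun c hc => by
      have h1 : ∑ i, c i • (s.equivFin.symm i).1 = 0 := by
        rw [← (Submodule.Quotient.mk_eq_zero _).2 hc]
        change _ = (localSum P 0).mkQ _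
        rw [map_sum]
        exact Finset.sum_congr rfl fun i _ => by rw [map_smul, hv]
      exact Fintype.linearIndependent_iff.1
        (hs.comp s.equivFin.symm s.equivFin.symm.injective) c h1)
    omega
  have hfd : FiniteDimensional W (F ⧸ localSum P 0) :=
    Module.rank_lt_aleph0_iff.1 (hrank.trans_lt (Cardinal.natCast_lt_aleph0))
  refine ⟨hfd, ?_⟩
  rw [← hg, Nat.cast_le]
  exact Module.finrank_le_of_rank_le hrank

/-- Vanishing of `H¹(A)` lets every polar part at `P` be realized globally, so `h⁰(A) + m ≤ h⁰(A +
mP)`. For large `m` the right side is at most `deg A + m + 1 - g`, by comparison with a divisor `A₀`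
attaining the genus. -/
theorem finrank_H0_eq_of_localSum_eq_top (hF : IsFunctionFieldOne W F) {P : Point W F}
    {A : Divisor W F} (hA : localSum P A = ⊤) :
    (Module.finrank W (H0 A) : ℤ) = degree A + 1 - genus W F := by
  refine le_antisymm ?_ (by have := le_genus hF A; omega)
  obtain ⟨A₀, hA₀⟩ := exists_eq_genus hF
  -- Large enough for Riemann's inequality to give `A + mP - A₀` a nonzero section.
  let m := (degree A₀ - degree A + genus W F).natAbs
  let D : Divisor W F := m • Finsupp.single P 1
  have hD : 0 ≤ D := nsmul_nonneg (Finsupp.single_nonneg.2 zero_le_one) _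
  have hdeg : degree D = m := by simp [D]
  have hup : (Module.finrank W (H0 (A + D)) : ℤ) ≤ degree A + m + 1 - genus W F := by
    have hpos : 0 < Module.finrank W (H0 (A + D - A₀)) := by
      have := le_genus hF (A + D - A₀)
      rw [degree_sub, degree_add, hdeg] at this
      omega
    have := finiteDimensional_H0 hF (A + D - A₀)
    obtain ⟨z, hz⟩ := (Module.finrank_pos_iff_exists_ne_zero (R := W)).1 hpos
    obtain ⟨Z, hZ⟩ := exists_isDivisorOf hF (fun h => hz (Subtype.ext h) : (z : F) ≠ 0)
    have hle : A₀ ≤ A + D + Z := by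
      intro x
      have := mem_H0.1 z.2 x
      rw [hZ.2, WithZero.exp_le_exp] at this
      simp only [Finsupp.sub_apply, Finsupp.add_apply] at this ⊢
      omega
    have h2 := finrank_H0_le hF hle
    rw [finrank_H0_add_of_isDivisorOf hZ, degree_add, degree_eq_zero_of_isDivisorOf hF hZ,
      degree_add, hdeg] at h2
    omega
  obtain ⟨n, hn, f, hf, hind⟩ := exists_independent_modulo {P} A D hD (by
    intro x hx
    by_contra hxP
    simp only [Finset.mem_singleton] at hxP
    simp [D, Finsupp.single_eq_of_ne hxP] at hx)
  rw [Finset.coe_singleton] at hf hind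
  have hsplit : ∀ i, ∃ l ∈ H0 (A + D), f i - l ∈ functionsOn {P} A := by
    intro i
    obtain ⟨u, hu, l, hl, hul⟩ := Submodule.mem_sup.1 (hA.ge (Submodule.mem_top (x := f i)))
    have hle : ∀ x, A x ≤ (A + D : Divisor W F) x := fun x => by
      have : 0 ≤ D x := hD x
      rw [Finsupp.add_apply]
      omega
    refine ⟨l, ?_, by rwa [← hul, add_sub_cancel_right]⟩
    rw [mem_H0]
    intro x
    by_cases hx : x = P
    · have := Submodule.sub_mem _ (hf i)
        (functionsOn_mono (M := ⇑A + ⇑D) (fun x _ => hle x) hu) x hx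
      rwa [← hul, add_sub_cancel_left] at this
    · exact (hl x hx).trans (WithZero.exp_le_exp.2 (hle x))
  choose l hl hfl using hsplit
  have := finiteDimensional_H0 hF (A + D)
  have := finiteDimensional_H0 hF A
  let φ : (Fin n → W) × H0 A →ₗ[W] H0 (A + D) :=
    LinearMap.coprod (Fintype.linearCombination W fun i => ⟨l i, hl i⟩)
      (Submodule.inclusion (H0_mono (le_add_of_nonneg_right hD)))
  have hφ : ∀ p, (φ p : F) = ∑ i, p.1 i • l i + (p.2 : F) := fun p => by
    simp [φ, Fintype.linearCombination_apply]
  have hinj : Function.Injective φ := by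
    rw [← LinearMap.ker_eq_bot, eq_bot_iff]
    rintro ⟨c, h⟩ hp
    have hp : ∑ i, c i • l i + (h : F) = 0 := by
      rw [← hφ (c, h), LinearMap.mem_ker.1 hp]
      rfl
    have hc : ∀ i, c i = 0 := by
      refine hind c ?_
      have h1 : ∑ i, c i • f i = ∑ i, c i • (f i - l i) - (h : F) := by
        simp only [smul_sub, Finset.sum_sub_distrib]
        rw [sub_sub, hp, sub_zero]
      rw [h1]
      exact Submodule.sub_mem _ (Submodule.sum_mem _ fun i _ => Submodule.smul_mem _ _ (hfl i))
        fun x _ => mem_H0.1 h.2 x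
    have hc0 : c = 0 := funext hc
    subst hc0
    rw [Submodule.mem_bot]
    exact Prod.ext rfl (Subtype.ext (by simpa using hp))
  have := LinearMap.finrank_le_finrank_of_injective hinj
  rw [Module.finrank_prod, Module.finrank_fin_fun] at this
  omega

/-- The Riemann-Roch theorem for divisors of large degree. -/
theorem finrank_H0_eq_of_le_degree (hF : IsFunctionFieldOne W F) (P : Point W F)
    {A : Divisor W F} (hA : 2 * genus W F - 1 ≤ degree A) :
    (Module.finrank W (H0 A) : ℤ) = degree A + 1 - genus W F := by
  by_contra hne
  have hlt := lt_top_iff_ne_top.2 fun h => hne (finrank_H0_eq_of_localSum_eq_top hF (P := P) h)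
  obtain ⟨ω, hω0, hω⟩ := Submodule.exists_le_ker_of_lt_top _ hlt
  obtain ⟨hfd, hle⟩ := finiteDimensional_quotient_localSum hF P
  -- A nonzero functional `ω` killing `localSum P A` acts as a differential: `f ↦ ω(f ·)` embeds
  -- `H⁰(A)` in the dual of `H¹(𝒪)`, so `h⁰(A) ≤ g`. The assumed failure gives `h⁰(A) > deg A + 1 -
  -- g ≥ g`.
  let Φ : H0 A →ₗ[W] (localSum P 0).dualAnnihilator :=
    LinearMap.codRestrict _ (((LinearMap.mul W F).compr₂ ω).domRestrict (H0 A)) (by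
      intro f
      rw [Submodule.mem_dualAnnihilator]
      intro h hh
      obtain ⟨u, hu, l, hl, rfl⟩ := Submodule.mem_sup.1 hh
      refine hω ?_
      change (f : F) * (u + l) ∈ _
      rw [mul_add]
      refine Submodule.add_mem _ (Submodule.mem_sup_left ?_) (Submodule.mem_sup_right ?_)
      · simpa using mul_mem_functionsOn (functionsOn_mono (M := A) (fun _ _ => le_rfl)
          (fun x _ => mem_H0.1 f.2 x)) hu
      · simpa using mul_mem_functionsOn (functionsOn_mono (M := A) (fun _ _ => le_rfl)
          (fun x _ => mem_H0.1 f.2 x)) hl)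
  have hΦ : Function.Injective Φ := by
    refine (injective_iff_map_eq_zero Φ).2 fun f hf => ?_
    by_contra hf0
    have hf0 : (f : F) ≠ 0 := fun h => hf0 (Subtype.ext h)
    apply hω0
    ext h
    have h1 := LinearMap.congr_fun (congrArg Subtype.val hf) ((f : F)⁻¹ * h)
    change ω ((f : F) * ((f : F)⁻¹ * h)) = 0 at h1
    rwa [mul_inv_cancel_left₀ hf0] at h1
  have hfd' : FiniteDimensional W (localSum P 0).dualAnnihilator :=
    (Submodule.dualQuotEquivDualAnnihilator (localSum P 0)).finiteDimensional
  have h1 := LinearMap.finrank_le_finrank_of_injective hΦ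
  rw [← (Submodule.dualQuotEquivDualAnnihilator (localSum P 0)).finrank_eq,
    Subspace.dual_finrank_eq] at h1
  have := le_genus hF A
  omega

end RiemannRoch

/-! ### Extension of constants from `k` to `W` -/

section BaseChange

variable {k K W : Type*} [Field k] [Field K] [Algebra k K] [Field W] [Algebra k W]

/-- Applying a linear functional to the coefficients in `W`. -/
def slice (K : Type*) [Field K] [Algebra k K] (l : W →ₗ[k] k) : W ⊗[k] K →ₗ[k] K :=
  TensorProduct.lid k K ∘ₗ l.rTensor K

@[simp]
theorem slice_tmul (l : W →ₗ[k] k) (w : W) (a : K) : slice K l (w ⊗ₜ a) = l w • a := by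
  simp [slice]

theorem exists_functional_eq_one {w : W} (hw : w ≠ 0) : ∃ l : W →ₗ[k] k, l w = 1 := by
  obtain ⟨l, hl⟩ : ∃ l : W →ₗ[k] k, l w ≠ 0 := by
    by_contra! h
    exact hw ((Module.forall_dual_apply_eq_zero_iff k w).1 h)
  exact ⟨(l w)⁻¹ • l, by simp [hl]⟩

/-- A `k`-linear functional equal to `1` on a nonzero coefficient turns a relation over `W` into a
nontrivial one over `k`. -/
theorem transcendental_includeRight {t : K} (ht : Transcendental k t) :
    Transcendental W ((1 : W) ⊗ₜ[k] t) := by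
  rw [transcendental_iff] at ht ⊢
  intro p hp
  ext j
  by_contra hj
  obtain ⟨l, hl⟩ := exists_functional_eq_one (k := k) hj
  have h := congrArg (slice K l) hp
  rw [aeval_eq_sum_range, map_zero, map_sum] at h
  have h2 : aeval t (∑ i ∈ Finset.range (p.natDegree + 1), C (l (p.coeff i)) * X ^ i) = 0 := by
    rw [← h, map_sum]
    refine Finset.sum_congr rfl fun i _ => ?_
    rw [map_mul, aeval_C, map_pow, aeval_X, Algebra.TensorProduct.tmul_pow, one_pow,
      TensorProduct.smul_tmul', slice_tmul, smul_eq_mul, mul_one, Algebra.smul_def]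
  have h3 := congrArg (fun q => coeff q j) (ht _ h2)
  simp only [finsetSum_coeff, coeff_C_mul, coeff_X_pow, coeff_zero] at h3
  rw [Finset.sum_eq_single j (fun i _ hi => by rw [if_neg (Ne.symm hi), mul_zero])
    (fun hjn => by
      rw [coeff_eq_zero_of_natDegree_lt (by simpa using hjn), map_zero, zero_mul])] at h3
  rw [if_pos rfl, mul_one, hl] at h3
  exact one_ne_zero h3

theorem incl_apply (a : K) :
    incl k K W a = algebraMap (W ⊗[k] K) (FBar k K W) (1 ⊗ₜ a) := rfl

theorem algebraMap_FBar (c : W) :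
    algebraMap W (FBar k K W) c = algebraMap (W ⊗[k] K) (FBar k K W) (c ⊗ₜ 1) := by
  rw [IsScalarTower.algebraMap_apply W (W ⊗[k] K) (FBar k K W)]
  rfl

theorem algebraMap_tmul (c : W) (a : K) :
    algebraMap (W ⊗[k] K) (FBar k K W) (c ⊗ₜ a) =
      algebraMap W (FBar k K W) c * incl k K W a := by
  rw [incl_apply, algebraMap_FBar, ← map_mul, Algebra.TensorProduct.tmul_mul_tmul, mul_one,
    one_mul]

theorem incl_algebraMap (c : k) :
    incl k K W (algebraMap k K c) = algebraMap W (FBar k K W) (algebraMap k W c) := by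
  rw [incl_apply, algebraMap_FBar]
  congr 1
  rw [Algebra.algebraMap_eq_smul_one (A := K), Algebra.algebraMap_eq_smul_one (A := W),
    TensorProduct.smul_tmul]

variable [IsDomain (W ⊗[k] K)]

variable (W) in
-- The images of a finite basis of `K` over `k(t)` are integral over `W(T)` and generate the whole
-- field over it.
theorem isFunctionFieldOne_FBar (hK : IsFunctionFieldOne k K) :
    IsFunctionFieldOne W (FBar k K W) := by
  obtain ⟨t, ht, hfin⟩ := hK
  let T := incl k K W t
  refine ⟨T, ?_, ?_⟩
  · exact (transcendental_algebraMap_iff (IsFractionRing.injective _ _)).2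
      (transcendental_includeRight ht)
  · let L := IntermediateField.adjoin W {T}
    let L₀ := IntermediateField.adjoin k {t}
    have hL₀ : ∀ a ∈ L₀, incl k K W a ∈ L := by
      intro a ha
      refine IntermediateField.adjoin_induction (F := k) (p := fun a _ => incl k K W a ∈ L)
        ?_ ?_ ?_ ?_ ?_ ha
      · rintro _ rfl
        exact IntermediateField.mem_adjoin_simple_self W T
      · intro c
        rw [incl_algebraMap]
        exact L.algebraMap_mem _
      · intro x y _ _ hx hy
        rw [map_add]
        exact add_mem hx hy
      · intro x _ hx
        rw [map_inv₀]
        exact inv_mem hx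
      · intro x y _ _ hx hy
        rw [map_mul]
        exact mul_mem hx hy
    let φ : L₀ →+* L := ((incl k K W).comp (algebraMap L₀ K)).codRestrict L
      (fun a => hL₀ a.1 a.2)
    have hint : ∀ a : K, IsIntegral L (incl k K W a) := fun a =>
      IsIntegral.map_of_comp_eq φ (incl k K W) rfl (Algebra.IsIntegral.isIntegral (R := L₀) a)
    let b := Module.finBasis L₀ K
    let S : Set (FBar k K W) := Set.range fun i => incl k K W (b i)
    let L' := IntermediateField.adjoin L S
    have hL' : FiniteDimensional L L' :=
      IntermediateField.finiteDimensional_adjoin (by rintro _ ⟨i, rfl⟩; exact hint _)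
    have hinclL' : ∀ a : K, incl k K W a ∈ L' := by
      intro a
      rw [← b.sum_repr a, map_sum]
      refine sum_mem fun i _ => ?_
      rw [Algebra.smul_def, map_mul]
      refine mul_mem ?_ (IntermediateField.subset_adjoin L S ⟨i, rfl⟩)
      exact L'.algebraMap_mem (φ (b.repr a i))
    have hring : ∀ z : W ⊗[k] K, algebraMap _ (FBar k K W) z ∈ L' := by
      intro z
      induction z using TensorProduct.induction_on with
      | zero => rw [map_zero]; exact zero_mem _
      | tmul c a =>
        rw [algebraMap_tmul]
        exact mul_mem (L'.algebraMap_mem (algebraMap W L c)) (hinclL' a)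
      | add x y hx hy => rw [map_add]; exact add_mem hx hy
    have htop : L' = ⊤ := by
      rw [eq_top_iff]
      intro f _
      obtain ⟨x, y, -, rfl⟩ := IsFractionRing.div_surjective (A := W ⊗[k] K) f
      exact div_mem (hring x) (hring y)
    rw [htop] at hL'
    exact (IntermediateField.topEquiv (F := L) (E := FBar k K W)).toLinearEquiv.finiteDimensional

/-- Every closed point of `X` lies under a closed point of `X̄`. -/
theorem exists_point_above [IsAlgClosed W] (hK : IsFunctionFieldOne k K) (x : Point k K) :
    ∃ y : PointBar k K W, y.ring.comap (incl k K W) = x.ring := by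
  let O : Subalgebra k K := { x.ring.toSubring with algebraMap_mem' := x.algebraMap_mem }
  let B : Subalgebra W (W ⊗[k] K) := (Algebra.TensorProduct.map (AlgHom.id W W) O.val).range
  let A : Subring (FBar k K W) := B.toSubring.map (algebraMap (W ⊗[k] K) (FBar k K W))
  have hA : ∀ (c : W) (a : K), a ∈ x.ring →
      algebraMap (W ⊗[k] K) (FBar k K W) (c ⊗ₜ a) ∈ A := fun c a ha =>
    ⟨c ⊗ₜ a, ⟨c ⊗ₜ (⟨a, ha⟩ : O), by simp⟩, rfl⟩
  obtain ⟨π, hπ⟩ := x.exists_val_eq (-1)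
  have hπ0 := ne_zero_of_val_eq_exp x hπ
  have hπx : π ∈ x.ring := x.mem_ring_iff.2 (by
    rw [hπ, ← WithZero.exp_zero, WithZero.exp_le_exp]; omega)
  let πA : A := ⟨incl k K W π, hA 1 π hπx⟩
  -- In `W ⊗ 𝒪ₓ` an equation `π z = 1` is impossible: a functional on `W` with value `1` at `1`
  -- sends the left side into the maximal ideal of `𝒪ₓ` and the right side to `1`.
  have hI : Ideal.span {πA} ≠ ⊤ := by
    rw [Ne, Ideal.span_singleton_eq_top]
    intro hu
    obtain ⟨⟨_, z, ⟨z, rfl⟩, rfl⟩, hz⟩ := isUnit_iff_exists_inv.1 hu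
    have h1 : (1 ⊗ₜ π) * Algebra.TensorProduct.map (AlgHom.id W W) O.val z = 1 := by
      apply IsFractionRing.injective (W ⊗[k] K) (FBar k K W)
      rw [map_mul, map_one]
      exact congrArg Subtype.val hz
    obtain ⟨l, hl⟩ := exists_functional_eq_one (k := k) (one_ne_zero (α := W))
    have h2 : ∀ z : W ⊗[k] O, x.val (slice K l
        ((1 ⊗ₜ π) * Algebra.TensorProduct.map (AlgHom.id W W) O.val z)) < 1 := by
      intro z
      induction z using TensorProduct.induction_on with
      | zero => simp
      | tmul c a =>
        rw [Algebra.TensorProduct.map_tmul, Algebra.TensorProduct.tmul_mul_tmul, slice_tmul]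
        refine lt_of_le_of_lt (x.val_smul_le _ _) ?_
        rw [map_mul]
        refine lt_of_le_of_lt (mul_le_of_le_one_right' (x.val_le_one_of_mem a.2)) ?_
        rw [lt_one_iff, hπ]
      | add z w hz hw =>
        rw [map_add, mul_add, map_add]
        exact (Valuation.map_add _ _ _).trans_lt (max_lt hz hw)
    have h3 := h2 z
    rw [h1, Algebra.TensorProduct.one_def, slice_tmul, hl, one_smul, map_one] at h3
    exact lt_irrefl _ h3
  obtain ⟨V, hAV, hV⟩ := Ideal.image_subset_nonunits_valuationSubring _ hI
  have hπV : incl k K W π ∈ V.nonunits := hV ⟨πA, Ideal.subset_span rfl, rfl⟩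
  have hinclπ : incl k K W π ≠ 0 := by simpa using hπ0
  have hW : ∀ c : W, algebraMap W (FBar k K W) c ∈ V := fun c => by
    rw [algebraMap_FBar]
    exact hAV (hA c 1 x.ring.one_mem)
  have hO : ∀ a ∈ x.ring, incl k K W a ∈ V := fun a ha => hAV (hA 1 a ha)
  have hπV' : (incl k K W π)⁻¹ ∉ V :=
    ((ValuationSubring.mem_nonunits_iff_or _).1 hπV).resolve_left hinclπ
  have hVtop : V ≠ ⊤ := by
    rintro rfl
    exact hπV' (ValuationSubring.mem_top _)
  refine ⟨⟨V, hW, isDiscreteValuationRing_of_ne_top (isFunctionFieldOne_FBar W hK) V hW hVtop⟩, ?_⟩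
  ext a
  change incl k K W a ∈ V ↔ a ∈ x.ring
  refine ⟨fun ha => ?_, hO a⟩
  by_contra hax
  rw [x.mem_ring_iff, not_le] at hax
  have ha0 : a ≠ 0 := by rintro rfl; simp at hax
  obtain ⟨m, hm⟩ := x.exists_val_eq_exp ha0
  rw [hm, ← WithZero.exp_zero, WithZero.exp_lt_exp] at hax
  have h1 : (a * π)⁻¹ ∈ x.ring := by
    rw [x.mem_ring_iff, map_inv₀, map_mul, hm, hπ, ← WithZero.exp_add, ← WithZero.exp_neg,
      ← WithZero.exp_zero, WithZero.exp_le_exp]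
    omega
  apply hπV'
  have h2 := V.mul_mem _ _ ha (hO _ h1)
  rwa [← map_mul, mul_inv, mul_inv_cancel_left₀ ha0, map_inv₀] at h2

end BaseChange

/-! ### Twisting of valuations and divisors -/

section Twist

variable {k K W : Type*} [Field k] [Field K] [Algebra k K] [Field W] [Algebra k W]
  [Fintype k] [IsAlgClosed W]

theorem twistFun_zero (f : FBar k K W) : twistFun 0 f = f := rfl

theorem twistFun_add (m n : ℤ) (f : FBar k K W) :
    twistFun (m + n) f = twistFun m (twistFun n f) := by
  rw [twistFun, zpow_add]
  rfl

theorem twistFun_one_incl (a : K) : twistFun 1 (incl k K W a) = incl k K W a := by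
  rw [twistFun, zpow_one]
  exact frobF_incl k K W a

theorem twistFun_one_algebraMap (c : W) :
    twistFun 1 (algebraMap W (FBar k K W) c) =
      algebraMap W (FBar k K W) (c ^ Fintype.card k) := by
  rw [twistFun, zpow_one]
  exact frobF_algebraMap k K W c

variable [IsDomain (W ⊗[k] K)]

theorem Point.twist_val (n : ℤ) (x : PointBar k K W) (f : FBar k K W) :
    (Point.twist n x).val f = x.val (twistFun (-n) f) := by
  have := (Point.twist n x).val_unique
    (x.val.comap (twistFun (k := k) (K := K) (W := W) (-n)).toRingHom)
    (fun f => by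
      rw [← (Point.twist n x).mem_ring_iff]
      exact x.mem_ring_iff)
    (by
      obtain ⟨f, hf⟩ := x.exists_val_eq (-1)
      refine ⟨twistFun n f, ?_⟩
      change x.val (twistFun (-n) (twistFun n f)) = _
      rw [← twistFun_add, neg_add_cancel, twistFun_zero, hf])
  rw [← this]
  rfl

theorem Point.twist_add (m n : ℤ) (x : PointBar k K W) :
    Point.twist (m + n) x = Point.twist m (Point.twist n x) := by
  refine Point.ext_val fun f => ?_
  rw [Point.twist_val, Point.twist_val, Point.twist_val, ← twistFun_add, neg_add_rev]
  exact id

theorem Point.twist_zero (x : PointBar k K W) : Point.twist 0 x = x := by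
  refine Point.ext_val fun f => ?_
  rw [Point.twist_val, neg_zero, twistFun_zero]
  exact id

theorem Point.twist_injective (n : ℤ) :
    Function.Injective (Point.twist n : PointBar k K W → PointBar k K W) := by
  intro x y h
  have := congrArg (Point.twist (-n)) h
  rwa [← Point.twist_add, ← Point.twist_add, neg_add_cancel, Point.twist_zero,
    Point.twist_zero] at this

theorem twistDiv_apply_twist (n : ℤ) (E : DivisorBar k K W) (x : PointBar k K W) :
    twistDiv n E (Point.twist n x) = E x :=
  Finsupp.mapDomain_apply (Point.twist_injective n) E x

theorem twistDiv_apply (n : ℤ) (E : DivisorBar k K W) (x : PointBar k K W) :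
    twistDiv n E x = E (Point.twist (-n) x) := by
  conv_lhs => rw [← Point.twist_zero x, ← add_neg_cancel n, Point.twist_add]
  exact twistDiv_apply_twist n E _

theorem twistDiv_add (n : ℤ) (A B : DivisorBar k K W) :
    twistDiv n (A + B) = twistDiv n A + twistDiv n B := Finsupp.mapDomain_add

theorem twistDiv_sub (n : ℤ) (A B : DivisorBar k K W) :
    twistDiv n (A - B) = twistDiv n A - twistDiv n B := by
  ext x
  simp [twistDiv_apply]

theorem twistDiv_single (n : ℤ) (x : PointBar k K W) (m : ℤ) :
    twistDiv n (Finsupp.single x m) = Finsupp.single (Point.twist n x) m :=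
  Finsupp.mapDomain_single

theorem twistFun_mem_H0 {E : DivisorBar k K W} {f : FBar k K W} (n : ℤ) (hf : f ∈ H0 E) :
    twistFun n f ∈ H0 (twistDiv n E) := by
  rw [mem_H0]
  intro x
  have := mem_H0.1 hf (Point.twist (-n) x)
  rwa [Point.twist_val, neg_neg, ← twistDiv_apply] at this

end Twist

/-! ### Base change of the conductor -/

section BaseChangeDivisor

variable {k K W : Type*} [Field k] [Field K] [Algebra k K] [Field W] [Algebra k W]
  [IsDomain (W ⊗[k] K)] {D : Divisor k K} {Dbar : DivisorBar k K W}

theorem IsBaseChange.nonneg (h : IsBaseChange D Dbar) (hD : 0 ≤ D) : 0 ≤ Dbar := by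
  intro y
  by_cases hy : ∃ x : Point k K, y.ring.comap (incl k K W) = x.ring
  · obtain ⟨x, hx⟩ := hy
    obtain ⟨a, ha⟩ := x.exists_val_eq (-(D x))
    have h1 := h.1 y x hx a ha
    have h2 : a ∈ x.ring := by
      rw [x.mem_ring_iff, ha, ← WithZero.exp_zero, WithZero.exp_le_exp]
      have : 0 ≤ D x := hD x
      omega
    rw [← hx] at h2
    have h3 : y.val (incl k K W a) ≤ 1 := y.mem_ring_iff.1 h2
    rw [h1, ← WithZero.exp_zero, WithZero.exp_le_exp] at h3
    rw [Finsupp.zero_apply]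
    omega
  · push Not at hy
    rw [h.2 y hy]
    rfl

theorem IsBaseChange.exists_point_below (h : IsBaseChange D Dbar) {y : PointBar k K W}
    (hy : y ∈ Dbar.support) : ∃ x ∈ D.support, y.ring.comap (incl k K W) = x.ring := by
  by_cases hyx : ∃ x : Point k K, y.ring.comap (incl k K W) = x.ring
  · obtain ⟨x, hx⟩ := hyx
    refine ⟨x, ?_, hx⟩
    rw [Finsupp.mem_support_iff]
    intro h0
    have := h.1 y x hx 1 (by rw [h0]; simp)
    rw [map_one, map_one, eq_comm, WithZero.exp_eq_one] at this
    simp at hy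
    omega
  · push Not at hyx
    simp [h.2 y hyx] at hy

theorem IsBaseChange.incl_mem_polesAlong (h : IsBaseChange D Dbar) {a : K}
    (ha : a ∈ polesAlong D) : incl k K W a ∈ polesAlong Dbar := by
  intro y hy
  obtain ⟨x, hxD, hx⟩ := h.exists_point_below hy
  obtain ⟨b, hb⟩ := x.exists_val_eq (-(D x))
  have h1 := h.1 y x hx b hb
  have h2 : a * b ∈ x.ring := by
    rw [x.mem_ring_iff, map_mul, hb]
    refine (mul_le_mul_left (ha x hxD) _).trans ?_
    rw [← WithZero.exp_add, add_neg_cancel, WithZero.exp_zero]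
  rw [← hx] at h2
  have h3 : y.val (incl k K W (a * b)) ≤ 1 := y.mem_ring_iff.1 h2
  rw [map_mul, map_mul, h1, WithZero.exp_neg, ← div_eq_mul_inv,
    div_le_one₀ WithZero.exp_pos] at h3
  exact h3

theorem IsBaseChange.incl_mem_regularAlong (h : IsBaseChange D Dbar)
    {a : K} (ha : a ∈ regularAlong D) : incl k K W a ∈ regularAlong Dbar := by
  intro y hy
  obtain ⟨x, hxD, hx⟩ := h.exists_point_below hy
  have h2 := ha x hxD
  rw [Pi.zero_apply, WithZero.exp_zero] at h2 ⊢
  rw [← x.mem_ring_iff, ← hx] at h2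
  exact y.mem_ring_iff.1 h2

variable [IsAlgClosed W]

theorem IsBaseChange.exists_pos_above (h : IsBaseChange D Dbar) (hK : IsFunctionFieldOne k K)
    (hD : 0 ≤ D) {x : Point k K} (hx : x ∈ D.support) :
    ∃ y ∈ Dbar.support, 0 < Dbar y ∧ y.ring.comap (incl k K W) = x.ring := by
  obtain ⟨y, hy⟩ := exists_point_above (W := W) hK x
  obtain ⟨a, ha⟩ := x.exists_val_eq (-(D x))
  have h1 := h.1 y x hy a ha
  have hDx : 0 < D x := lt_of_le_of_ne (hD x) (Ne.symm (Finsupp.mem_support_iff.1 hx))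
  have ha0 := ne_zero_of_val_eq_exp x ha
  have h2 : a⁻¹ ∉ x.ring := by
    rw [x.mem_ring_iff, map_inv₀, ha, ← WithZero.exp_neg, neg_neg, ← WithZero.exp_zero,
      WithZero.exp_le_exp]
    omega
  have h3 : ¬ y.val (incl k K W a⁻¹) ≤ 1 := by
    rw [← y.mem_ring_iff]
    rw [← hy] at h2
    exact h2
  rw [map_inv₀, map_inv₀, h1, ← WithZero.exp_neg, neg_neg, ← WithZero.exp_zero,
    WithZero.exp_le_exp, not_le] at h3
  exact ⟨y, Finsupp.mem_support_iff.2 h3.ne', h3, hy⟩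

theorem IsBaseChange.mem_regularAlong (h : IsBaseChange D Dbar) (hK : IsFunctionFieldOne k K)
    (hD : 0 ≤ D) {a : K} (ha : incl k K W a ∈ regularAlong Dbar) : a ∈ regularAlong D := by
  intro x hx
  obtain ⟨y, hy, -, hyx⟩ := h.exists_pos_above hK hD hx
  have h1 := ha y hy
  rw [Pi.zero_apply, WithZero.exp_zero] at h1 ⊢
  rw [← y.mem_ring_iff] at h1
  rw [← x.mem_ring_iff, ← hyx]
  exact h1

theorem IsBaseChange.degree_pos (h : IsBaseChange D Dbar) (hK : IsFunctionFieldOne k K)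
    (hD : 0 ≤ D) (hD0 : D ≠ 0) : 0 < degree Dbar := by
  obtain ⟨x, hx⟩ := Finsupp.support_nonempty_iff.2 hD0
  obtain ⟨y, hy, hpos, -⟩ := h.exists_pos_above hK hD hx
  exact lt_of_lt_of_le hpos (Finset.single_le_sum (f := Dbar) (fun z _ => h.nonneg hD z) hy)

/-- Twisting fixes `K`, so `y` and its twist lie above the same point of `X` and share the same
local equation from `K`. -/
theorem IsBaseChange.twistDiv_eq [Fintype k] (h : IsBaseChange D Dbar) :
    twistDiv 1 Dbar = Dbar := by
  ext y
  rw [twistDiv_apply]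
  have hcomap : (Point.twist (-1) y).ring.comap (incl k K W) = y.ring.comap (incl k K W) := by
    ext a
    change twistFun (- -1) (incl k K W a) ∈ y.ring ↔ incl k K W a ∈ y.ring
    rw [neg_neg, twistFun_one_incl]
  by_cases hyx : ∃ x : Point k K, y.ring.comap (incl k K W) = x.ring
  · obtain ⟨x, hx⟩ := hyx
    obtain ⟨a, ha⟩ := x.exists_val_eq (-(D x))
    have h1 := h.1 y x hx a ha
    have h2 := h.1 _ x (hcomap.trans hx) a ha
    rw [Point.twist_val, neg_neg, twistFun_one_incl, h1, WithZero.exp_inj] at h2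
    omega
  · push Not at hyx
    rw [h.2 y hyx, h.2 _ fun x => hcomap ▸ hyx x]

end BaseChangeDivisor

/-! ### Semilinear operators -/

section Semilinear

/-- Surjectivity of `σ` lets coefficients be pulled back through `τ`; hence `τ` carries a basis of
`U` to an independent family of the same size, again a basis, and each combination of it is a value
of `τ`. -/
theorem exists_apply_eq_of_semilinear {W V : Type*} [Field W] [AddCommGroup V] [Module W V]
    {σ : W →+* W} (hσ : Function.Surjective σ) {τ : V →ₛₗ[σ] V} (hτ : Function.Injective τ)
    {U : Submodule W V} [FiniteDimensional W U] (hU : ∀ f ∈ U, τ f ∈ U) :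
    ∀ f ∈ U, ∃ g ∈ U, τ g = f := by
  let b := Module.finBasis W U
  have hsum : ∀ c : Fin (Module.finrank W U) → W, ∃ g ∈ U, τ g = ∑ i, c i • τ (b i) ∧
      (g = 0 → ∀ i, c i = 0) := by
    intro c
    choose d hd using fun i => hσ (c i)
    refine ⟨∑ i, d i • (b i : V), Submodule.sum_mem _ fun i _ => Submodule.smul_mem _ _ (b i).2,
      ?_, fun h i => ?_⟩
    · rw [map_sum]
      exact Finset.sum_congr rfl fun i _ => by rw [LinearMap.map_smulₛₗ, hd]
    · have := Fintype.linearIndependent_iff.1 b.linearIndependent d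
        (Subtype.ext (by simpa using h)) i
      rw [← hd, this, map_zero]
  let v : Fin (Module.finrank W U) → U := fun i => ⟨τ (b i), hU _ (b i).2⟩
  have hv : LinearIndependent W v := by
    rw [Fintype.linearIndependent_iff]
    intro c hc
    obtain ⟨g, -, hg, hg0⟩ := hsum c
    refine hg0 (hτ ?_)
    rw [hg, map_zero]
    simpa [v] using congrArg Subtype.val hc
  have hspan := hv.span_eq_top_of_card_eq_finrank' (by simp)
  intro f hf
  obtain ⟨c, hc⟩ := (Submodule.mem_span_range_iff_exists_fun W).1
    (hspan.ge (Submodule.mem_top (x := (⟨f, hf⟩ : U))))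
  obtain ⟨g, hgU, hg, -⟩ := hsum c
  refine ⟨g, hgU, ?_⟩
  rw [hg]
  simpa [v] using congrArg Subtype.val hc

/-- The span of the images of `V₀` under `1, τ, …, τ ^ n`. -/
def krylov {W V : Type*} [Field W] [AddCommGroup V] [Module W V] {σ : W →+* W}
    [RingHomSurjective σ] (τ : V →ₛₗ[σ] V) (V₀ : Submodule W V) : ℕ → Submodule W V
  | 0 => V₀
  | n + 1 => V₀ ⊔ (krylov τ V₀ n).map τ

theorem krylov_le_succ {W V : Type*} [Field W] [AddCommGroup V] [Module W V] {σ : W →+* W}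
    [RingHomSurjective σ] (τ : V →ₛₗ[σ] V) (V₀ : Submodule W V) (n : ℕ) :
    krylov τ V₀ n ≤ krylov τ V₀ (n + 1) := by
  induction n with
  | zero => exact le_sup_left
  | succ n ih => exact sup_le_sup_left (Submodule.map_mono ih) _

theorem le_krylov {W V : Type*} [Field W] [AddCommGroup V] [Module W V] {σ : W →+* W}
    [RingHomSurjective σ] (τ : V →ₛₗ[σ] V) (V₀ : Submodule W V) (n : ℕ) :
    V₀ ≤ krylov τ V₀ n := by
  cases n with
  | zero => exact le_rfl
  | succ n => exact le_sup_left

end Semilinear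

/-! ### The operator `τ` and Drinfeld's vanishing lemma -/

section Vanishing

variable {k K W : Type*} [Field k] [Field K] [Algebra k K] [Field W] [Algebra k W]
  [Fintype k] [IsAlgClosed W]

variable (k W) in
/-- The `q`-th power map of `W` as a ring homomorphism. -/
def frobHom : W →+* W := (frobW k W).toRingEquiv.toRingHom

theorem frobHom_surjective : Function.Surjective (frobHom k W) := (frobW k W).surjective

instance : RingHomSurjective (frobHom k W) := ⟨frobHom_surjective⟩

variable [IsDomain (W ⊗[k] K)]

/-- The semilinear operator `f ↦ f⁽¹⁾ / φ`. -/
def tau (φ : FBar k K W) : FBar k K W →ₛₗ[frobHom k W] FBar k K W where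
  toFun f := φ⁻¹ * twistFun 1 f
  map_add' f g := by rw [map_add, mul_add]
  map_smul' c f := by
    rw [Algebra.smul_def, map_mul, twistFun_one_algebraMap, Algebra.smul_def]
    exact mul_left_comm _ _ _

theorem tau_apply (φ f : FBar k K W) : tau φ f = φ⁻¹ * twistFun 1 f := rfl

theorem tau_injective {φ : FBar k K W} (hφ : φ ≠ 0) : Function.Injective (tau φ) := by
  intro f g h
  exact (twistFun 1).injective (mul_right_injective₀ (inv_ne_zero hφ) h)

theorem twistFun_mem_H0_iff {E : DivisorBar k K W} {f : FBar k K W} :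
    twistFun 1 f ∈ H0 (twistDiv 1 E) ↔ f ∈ H0 E := by
  refine ⟨fun h => ?_, twistFun_mem_H0 1⟩
  rw [mem_H0] at h ⊢
  intro x
  have := h (Point.twist 1 x)
  rwa [Point.twist_val, twistDiv_apply_twist, ← twistFun_add, neg_add_cancel, twistFun_zero]
    at this

/-- Twisting moves `E' + A` to its twist, and division by `φ` shifts by the divisor of `φ`. The same
`φ` serves for `E' = E` and for `E' = E + D`, since `D` is invariant under twisting. -/
theorem tau_mem_iff {E' A : DivisorBar k K W} {ξ η : PointBar k K W} {φ f : FBar k K W}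
    (hφ : IsDivisorOf
      (E' - twistDiv 1 E' - (-Finsupp.single (Point.twist 1 ξ) 1 + Finsupp.single η 1)) φ) :
    tau φ f ∈ H0 (E' + twistDiv 1 A + Finsupp.single (Point.twist 1 ξ) 1 - Finsupp.single η 1) ↔
      f ∈ H0 (E' + A) := by
  rw [← twistFun_mem_H0_iff (f := f), twistDiv_add]
  have h : E' + twistDiv 1 A + Finsupp.single (Point.twist 1 ξ) 1 - Finsupp.single η 1 =
      twistDiv 1 E' + twistDiv 1 A +
      (E' - twistDiv 1 E' - (-Finsupp.single (Point.twist 1 ξ) 1 + Finsupp.single η 1)) := by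
    abel
  rw [h, ← hφ.mul_mem_H0_iff, tau_apply, mul_inv_cancel_left₀ hφ.1]

/-- The divisor `x + x⁽¹⁾ + ⋯ + x⁽ᴺ⁻¹⁾`. -/
def orbitDiv (x : PointBar k K W) (N : ℕ) : DivisorBar k K W :=
  ∑ i ∈ Finset.range N, Finsupp.single (Point.twist i x) 1

theorem orbitDiv_zero (x : PointBar k K W) : orbitDiv x 0 = 0 := rfl

theorem orbitDiv_succ (x : PointBar k K W) (N : ℕ) :
    orbitDiv x (N + 1) = orbitDiv x N + Finsupp.single (Point.twist N x) 1 :=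
  Finset.sum_range_succ _ _

theorem twistDiv_orbitDiv_add_single (x : PointBar k K W) (N : ℕ) :
    twistDiv 1 (orbitDiv x N) + Finsupp.single x 1 = orbitDiv x (N + 1) := by
  induction N with
  | zero =>
    rw [orbitDiv_succ, orbitDiv_zero, Nat.cast_zero, Point.twist_zero]
    congr 1
  | succ N ih =>
    rw [orbitDiv_succ, twistDiv_add, add_right_comm, ih, orbitDiv_succ x (N + 1), twistDiv_single,
      ← Point.twist_add, add_comm 1, Nat.cast_add, Nat.cast_one]

theorem orbitDiv_apply_eq_zero {x y : PointBar k K W} {N : ℕ}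
    (h : ∀ i < N, Point.twist i x ≠ y) : orbitDiv x N y = 0 := by
  rw [orbitDiv, Finsupp.finsetSum_apply]
  refine Finset.sum_eq_zero fun i hi => ?_
  rw [Finsupp.single_eq_of_ne (h i (Finset.mem_range.1 hi)).symm]

theorem degree_orbitDiv (x : PointBar k K W) (N : ℕ) : degree (orbitDiv x N) = N := by
  rw [orbitDiv, degree_sum]
  simp

theorem mem_H0_of_le_or_le {k K : Type*} [Field k] [Field K] [Algebra k K] {A B C : Divisor k K}
    {f : K} (hA : f ∈ H0 A) (hB : f ∈ H0 B) (h : ∀ x, A x ≤ C x ∨ B x ≤ C x) : f ∈ H0 C := by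
  rw [mem_H0] at *
  intro x
  rcases h x with h | h
  · exact (hA x).trans (WithZero.exp_le_exp.2 h)
  · exact (hB x).trans (WithZero.exp_le_exp.2 h)

theorem mem_H0_sub_add {k K : Type*} [Field k] [Field K] [Algebra k K] {A B C : Divisor k K}
    {x : Point k K} {f : K}
    (hA : f ∈ H0 (A - Finsupp.single x 1)) (hB : f ∈ H0 (A - B)) (hx : B x = 0)
    (hC : C = A - Finsupp.single x 1 - B) : f ∈ H0 C := by
  subst hC
  refine mem_H0_of_le_or_le hA hB fun y => ?_
  by_cases hy : y = x
  · subst hy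
    left
    simp [hx]
  · right
    simp [Finsupp.single_eq_of_ne hy]

/-- Functions in a `τ`-stable set that vanish at `ξ` vanish along the orbit of `η`. -/
theorem mem_H0_sub_orbitDiv {E' : DivisorBar k K W} {ξ η : PointBar k K W} {φ : FBar k K W}
    (hφ : IsDivisorOf
      (E' - twistDiv 1 E' - (-Finsupp.single (Point.twist 1 ξ) 1 + Finsupp.single η 1)) φ)
    {U : Set (FBar k K W)} (hξ : ∀ f ∈ U, f ∈ H0 (E' - Finsupp.single ξ 1))
    (hU : ∀ f ∈ U, ∃ g ∈ U, tau φ g = f) {N : ℕ} (hη : ∀ i < N, Point.twist (i : ℤ) η ≠ ξ) :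
    ∀ f ∈ U, f ∈ H0 (E' - orbitDiv η N) := by
  induction N with
  | zero =>
    intro f hf
    rw [orbitDiv_zero, sub_zero]
    exact H0_mono (sub_le_self _ (Finsupp.single_nonneg.2 zero_le_one)) (hξ f hf)
  | succ N ih =>
    intro f hf
    obtain ⟨g, hg, rfl⟩ := hU f hf
    have h1 := ih (fun i hi => hη i (by omega)) g hg
    -- The zeros of `g` at `ξ` and along the orbit add up because `ξ` is not in that segment. Under
    -- `τ` the zero at `ξ` cancels the permitted pole at `ξ⁽¹⁾`, the orbit moves up by one, and `η`
    -- is added.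
    have h2 := mem_H0_sub_add (C := E' + -(Finsupp.single ξ 1 + orbitDiv η N)) (hξ g hg) h1
      (orbitDiv_apply_eq_zero fun i hi => hη i (by omega)) (by abel)
    rw [← tau_mem_iff hφ] at h2
    convert h2 using 2
    rw [← twistDiv_orbitDiv_add_single, ← zero_sub (_ + _), twistDiv_sub, twistDiv_add,
      twistDiv_single]
    have : twistDiv 1 (0 : DivisorBar k K W) = 0 := Finsupp.mapDomain_zero
    rw [this]
    abel

/-- A variant of Drinfeld's vanishing lemma. -/
theorem H0_eq_bot_of_nondegenerate (hF : IsFunctionFieldOne W (FBar k K W))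
    {E : DivisorBar k K W} {ξ η : PointBar k K W} {φ : FBar k K W}
    (hφ : IsDivisorOf
      (E - twistDiv 1 E - (-Finsupp.single (Point.twist 1 ξ) 1 + Finsupp.single η 1)) φ)
    (hdeg : degree E = genus W (FBar k K W) - 1)
    (hη : ∀ i : ℤ, 1 - genus W (FBar k K W) ≤ i → i ≤ genus W (FBar k K W) →
      η ≠ Point.twist i ξ) : H0 E = ⊥ := by
  obtain ⟨g, hg⟩ : ∃ g : ℕ, (g : ℤ) = genus W (FBar k K W) :=
    ⟨_, Int.toNat_of_nonneg (genus_nonneg hF)⟩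
  rw [← hg] at hdeg hη
  set ξ₁ := Point.twist 1 ξ with hξ₁
  have hηξ : ∀ i : ℕ, i ≤ g → orbitDiv ξ₁ i η = 0 := by
    intro i hi
    refine orbitDiv_apply_eq_zero fun j hj h => hη (j + 1) (by omega) (by omega) ?_
    rw [← h, hξ₁, ← Point.twist_add]
  -- `τ` shifts the orbit of `ξ`
  have hshift : ∀ (i : ℕ) (f : FBar k K W), f ∈ H0 (E + orbitDiv ξ₁ i) ↔
      tau φ f ∈ H0 (E + orbitDiv ξ₁ (i + 1) - Finsupp.single η 1) := by
    intro i f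
    rw [← tau_mem_iff hφ, ← hξ₁, ← twistDiv_orbitDiv_add_single, add_assoc]
  have hkry : ∀ i : ℕ, krylov (tau φ) (H0 E) i ≤ H0 (E + orbitDiv ξ₁ i) := by
    intro i
    induction i with
    | zero => rw [orbitDiv_zero, add_zero]; exact le_rfl
    | succ i ih =>
      refine sup_le (H0_mono (le_add_of_nonneg_right
        (Finset.sum_nonneg fun j _ => Finsupp.single_nonneg.2 zero_le_one))) ?_
      rintro _ ⟨f, hf, rfl⟩
      exact H0_mono (sub_le_self _ (Finsupp.single_nonneg.2 zero_le_one))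
        ((hshift i f).1 (ih hf))
  have hfd : ∀ i : ℕ, FiniteDimensional W (krylov (tau φ) (H0 E) i) := fun i =>
    have := finiteDimensional_H0 hF (E + orbitDiv ξ₁ i)
    Submodule.finiteDimensional_of_le (hkry i)
  -- Either the chain becomes `τ`-stable before step `g`, or it gains a dimension at each of the
  -- first `g` steps.
  by_cases hstable : ∃ i < g, krylov (tau φ) (H0 E) (i + 1) ≤ krylov (tau φ) (H0 E) i
  · obtain ⟨i, hi, hle⟩ := hstable
    rw [eq_bot_iff]
    refine (le_krylov (tau φ) (H0 E) i).trans ?_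
    have hUi := hkry i
    set U := krylov (tau φ) (H0 E) i
    have hUτ : ∀ f ∈ U, tau φ f ∈ U := fun f hf =>
      hle ((le_sup_right : U.map (tau φ) ≤ _) ⟨f, hf, rfl⟩)
    have := hfd i
    have hU := exists_apply_eq_of_semilinear frobHom_surjective (tau_injective hφ.1) hUτ
    -- functions in `U` vanish at `η`
    have hvan : ∀ j : ℕ, j ≤ i → (∀ f ∈ U, f ∈ H0 (E + orbitDiv ξ₁ j)) →
        ∀ f ∈ U, f ∈ H0 (E + orbitDiv ξ₁ j - Finsupp.single η 1) := by
      intro j hj h f hf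
      obtain ⟨g', hg', rfl⟩ := hU f hf
      -- The bound coming from `τ` has the zero at `η`, where by nondegeneracy neither orbit segment
      -- permits a pole; away from `η` the bound `h` suffices.
      refine mem_H0_of_le_or_le ((hshift j g').1 (h g' hg')) (h _ hf) fun x => ?_
      by_cases hx : x = η
      · subst hx
        left
        simp [hηξ j (by omega), hηξ (j + 1) (by omega)]
      · right
        simp [Finsupp.single_eq_of_ne hx]
    -- The extra zero of `τ f` at `η` is exactly what the converse direction of `hshift` needs to
    -- drop the last pole of `f`.
    have hdesc : ∀ m : ℕ, m ≤ i → ∀ f ∈ U, f ∈ H0 (E + orbitDiv ξ₁ (i - m)) := by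
      intro m
      induction m with
      | zero => exact fun _ f hf => hUi hf
      | succ m ih =>
        intro hm f hf
        rw [hshift, show i - (m + 1) + 1 = i - m by omega]
        exact hvan (i - m) (by omega) (ih (by omega)) _ (hUτ f hf)
    have hUη := hvan 0 (by omega) (by simpa using hdesc i le_rfl)
    -- One more descent: with `A = -ξ`, the twist of `A` cancels `ξ⁽¹⁾`, so `τ f ∈ H⁰(E - η)` says
    -- that `f` vanishes at `ξ`.
    have hUξ : ∀ f ∈ U, f ∈ H0 (E - Finsupp.single ξ 1) := by
      intro f hf
      rw [sub_eq_add_neg, ← tau_mem_iff hφ]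
      convert hUη _ (hUτ f hf) using 2
      have : twistDiv 1 (-Finsupp.single ξ 1 : DivisorBar k K W) = -Finsupp.single ξ₁ 1 := by
        rw [← Finsupp.single_neg, twistDiv_single, Finsupp.single_neg]
      rw [this, orbitDiv_zero]
      abel
    intro f hf
    have h := mem_H0_sub_orbitDiv hφ (U := U) hUξ hU (N := g) (fun i hi h =>
      hη (-i) (by omega) (by omega) (by
        rw [← h, ← Point.twist_add, neg_add_cancel, Point.twist_zero])) f hf
    rwa [H0_eq_bot_of_degree_neg hF (by rw [degree_sub, degree_orbitDiv, hdeg]; omega)] at h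
  · push Not at hstable
    have hgrow : ∀ i ≤ g, Module.finrank W (H0 E) + i ≤
        Module.finrank W (krylov (tau φ) (H0 E) i) := by
      intro i
      induction i with
      | zero => exact fun _ => le_rfl
      | succ i ih =>
        intro hi
        have := hfd (i + 1)
        have hlt := Submodule.finrank_lt_finrank_of_lt
          (lt_of_le_not_ge (krylov_le_succ (tau φ) (H0 E) i) (hstable i (by omega)))
        have := ih (by omega)
        omega
    have h1 := hgrow g le_rfl
    have := finiteDimensional_H0 hF (E + orbitDiv ξ₁ g)
    have h2 := Submodule.finrank_mono (hkry g)
    -- The degree is `(g - 1) + g = 2g - 1`, so the dimension is exactly `g`, leaving no room for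
    -- `H⁰(E)`.
    have h3 := finrank_H0_eq_of_le_degree hF ξ (A := E + orbitDiv ξ₁ g) (by
      rw [degree_add, degree_orbitDiv, hdeg, ← hg]; omega)
    rw [degree_add, degree_orbitDiv, hdeg, ← hg] at h3
    have := finiteDimensional_H0 hF E
    exact Submodule.finrank_eq_zero.1 (by omega)

end Vanishing

/-! ### Values of functions at points -/

section Evaluation

variable {W F : Type*} [Field W] [Field F] [Algebra W F]

theorem evalAt_eq {x : Point W F} {f : F} {c : W} (h : x.val (f - algebraMap W F c) < 1) :
    evalAt x f = c := by
  have hex : ∃ c : W, x.val (f - algebraMap W F c) < 1 := ⟨c, h⟩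
  rw [evalAt, dif_pos hex]
  by_contra hne
  have h1 := x.val_algebraMap (sub_ne_zero.2 hne)
  have h2 : x.val ((f - algebraMap W F c) - (f - algebraMap W F hex.choose)) < 1 :=
    (Valuation.map_sub _ _ _).trans_lt (max_lt h hex.choose_spec)
  rw [sub_sub_sub_cancel_left, ← map_sub, h1] at h2
  exact lt_irrefl _ h2

variable [IsAlgClosed W]

theorem val_sub_evalAt (hF : IsFunctionFieldOne W F) {x : Point W F} {f : F}
    (hf : x.val f ≤ 1) : x.val (f - algebraMap W F (evalAt x f)) < 1 := by
  obtain ⟨c, hc⟩ := x.exists_val_sub_lt_one hF hf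
  rwa [evalAt_eq hc]

theorem evalAt_eq_zero_iff (hF : IsFunctionFieldOne W F) {x : Point W F} {f : F}
    (hf : x.val f ≤ 1) : evalAt x f = 0 ↔ x.val f < 1 := by
  constructor
  · intro h
    simpa [h] using val_sub_evalAt hF hf
  · intro h
    exact evalAt_eq (by simpa using h)

theorem evalAt_add (hF : IsFunctionFieldOne W F) {x : Point W F} {f g : F}
    (hf : x.val f ≤ 1) (hg : x.val g ≤ 1) : evalAt x (f + g) = evalAt x f + evalAt x g := by
  apply evalAt_eq
  rw [map_add, add_sub_add_comm]
  exact (Valuation.map_add _ _ _).trans_lt (max_lt (val_sub_evalAt hF hf) (val_sub_evalAt hF hg))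

theorem evalAt_smul (hF : IsFunctionFieldOne W F) {x : Point W F} {f : F} (c : W)
    (hf : x.val f ≤ 1) : evalAt x (c • f) = c * evalAt x f := by
  apply evalAt_eq
  rw [map_mul, Algebra.smul_def, ← mul_sub, map_mul]
  exact lt_of_le_of_lt (mul_le_of_le_one_left' (x.val_algebraMap_le_one c)) (val_sub_evalAt hF hf)

theorem evalAt_sum (hF : IsFunctionFieldOne W F) {x : Point W F} {ι : Type*} (s : Finset ι)
    (c : ι → W) {f : ι → F} (hf : ∀ i, x.val (f i) ≤ 1) :
    evalAt x (∑ i ∈ s, c i • f i) = ∑ i ∈ s, c i * evalAt x (f i) := by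
  classical
  induction s using Finset.induction_on with
  | empty => simpa using evalAt_eq (x := x) (f := (0 : F)) (c := 0) (by simp)
  | insert i s hi ih =>
    rw [Finset.sum_insert hi, Finset.sum_insert hi, evalAt_add hF, ih, evalAt_smul hF _ (hf i)]
    · exact (x.val_smul_le _ _).trans (hf i)
    · exact Valuation.map_sum_le _ fun j _ => (x.val_smul_le _ _).trans (hf j)

theorem evalAt_div_mul (hF : IsFunctionFieldOne W F) {x : Point W F} {f g : F}
    (hf : x.val f ≤ 1) (hg : x.val g = 1) : evalAt x g * evalAt x (f / g) = evalAt x f := by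
  have hfg : x.val (f / g) ≤ 1 := by rwa [map_div₀, hg, div_one]
  symm
  apply evalAt_eq
  have hg0 : g ≠ 0 := by rintro rfl; simp at hg
  have : f - algebraMap W F (evalAt x g * evalAt x (f / g)) =
      g * (f / g - algebraMap W F (evalAt x (f / g))) +
        (g - algebraMap W F (evalAt x g)) * algebraMap W F (evalAt x (f / g)) := by
    rw [map_mul]
    field_simp
    ring
  rw [this]
  refine (Valuation.map_add _ _ _).trans_lt (max_lt ?_ ?_)
  · rw [map_mul, hg, one_mul]
    exact val_sub_evalAt hF hfg
  · rw [map_mul]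
    exact lt_of_le_of_lt (mul_le_of_le_one_right' (x.val_algebraMap_le_one _))
      (val_sub_evalAt hF hg.le)

end Evaluation

/-! ### The liftings `ψ_α` and their nonvanishing at `ξ` -/

section Lifting

theorem away_apply {k K : Type*} [Field k] [Field K] [Algebra k K] {D E : Divisor k K}
    (h : Away D E) {x : Point k K} (hx : x ∈ D.support) : E x = 0 :=
  Finsupp.notMem_support_iff.1 (Finset.disjoint_left.1 h hx)

theorem mem_H0_of_regularAlong {k K : Type*} [Field k] [Field K] [Algebra k K] {D E : Divisor k K}
    (h : Away D E) {f : K} (hf : f ∈ H0 (E + D)) (hfD : f ∈ regularAlong D) : f ∈ H0 E := by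
  rw [mem_H0] at *
  intro x
  by_cases hx : x ∈ D.support
  · rw [away_apply h hx]
    exact hfD x hx
  · simpa [Finsupp.notMem_support_iff.1 hx] using hf x

/-- The map from `H⁰(E + D)` to principal parts is injective because its kernel lies in `H⁰(E) = 0`.
The source has dimension at least `deg D` by Riemann's inequality and the target at most `deg D`, so
the map is onto. -/
theorem exists_lift {W F : Type*} [Field W] [Field F] [Algebra W F] [IsAlgClosed W]
    (hF : IsFunctionFieldOne W F) {D E : Divisor W F} (hD : 0 ≤ D) (haway : Away D E)
    (hdeg : degree E = genus W F - 1) (hE : H0 E = ⊥) {h : F} (hh : h ∈ polesAlong D) :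
    ∃ ψ ∈ H0 (E + D), ψ - h ∈ regularAlong D := by
  classical
  let R : Submodule W F := regularAlong D
  obtain ⟨T, hT, -, hspan⟩ := exists_span_modulo hF (D.support : Set (Point W F)) ⊤ 0 D hD
  rw [top_inf_eq, top_inf_eq, zero_add] at hspan
  have hpoles : (polesAlong D).map R.mkQ ≤
      Submodule.span W ((T.image R.mkQ : Finset (F ⧸ R)) : Set (F ⧸ R)) := by
    rintro _ ⟨p, hp, rfl⟩
    obtain ⟨u, hu, s, hs, rfl⟩ := Submodule.mem_sup.1 (hspan hp)
    rw [map_add, show R.mkQ u = 0 from (Submodule.Quotient.mk_eq_zero _).2 hu, zero_add,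
      Finset.coe_image, ← Submodule.map_span]
    exact ⟨s, hs, rfl⟩
  have hfdp : FiniteDimensional W ((polesAlong D).map R.mkQ) :=
    Submodule.finiteDimensional_of_le hpoles
  have hle : (H0 (E + D)).map R.mkQ ≤ (polesAlong D).map R.mkQ := by
    refine Submodule.map_mono fun f hf x hx => ?_
    have := mem_H0.1 hf x
    rwa [Finsupp.add_apply, away_apply haway hx, zero_add] at this
  have hinj : Function.Injective (R.mkQ.domRestrict (H0 (E + D))) := by
    refine (injective_iff_map_eq_zero _).2 fun f hf => ?_
    have h1 : (f : F) ∈ H0 E :=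
      mem_H0_of_regularAlong haway f.2 ((Submodule.Quotient.mk_eq_zero R).1 hf)
    rw [hE] at h1
    exact Subtype.ext h1
  have h1 : Module.finrank W ((H0 (E + D)).map R.mkQ) = Module.finrank W (H0 (E + D)) := by
    rw [← LinearMap.range_domRestrict]
    exact LinearMap.finrank_range_of_inj hinj
  have h2 := le_genus hF (E + D)
  rw [degree_add, hdeg] at h2
  have h3 : Module.finrank W ((polesAlong D).map R.mkQ) ≤ T.card :=
    (Submodule.finrank_mono hpoles).trans
      ((finrank_span_finset_le_card _).trans Finset.card_image_le)
  have heq := Submodule.eq_of_le_of_finrank_le hle (by omega)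
  obtain ⟨ψ, hψ, hψh⟩ := heq.ge ⟨h, hh, rfl⟩
  exact ⟨ψ, hψ, (Submodule.Quotient.eq R).1 hψh⟩

variable {k K W : Type*} [Field k] [Field K] [Algebra k K] [Field W] [Algebra k W]
  [IsDomain (W ⊗[k] K)] {D : Divisor k K} {Dbar : DivisorBar k K W}

theorem Lifts.sub_mem (hB : IsBaseChange D Dbar) {α : PrincipalParts D} {f g : FBar k K W}
    (hf : Lifts Dbar α f) (hg : Lifts Dbar α g) : f - g ∈ regularAlong Dbar := by
  obtain ⟨a, ha, hfa⟩ := hf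
  obtain ⟨b, hb, hgb⟩ := hg
  have hab : a - b ∈ (regularAlong D).submoduleOf (polesAlong D) :=
    (Submodule.Quotient.eq _).1 (ha.trans hb.symm)
  have h1 := hB.incl_mem_regularAlong (a := (a : K) - b) hab
  rw [map_sub] at h1
  have h2 := Submodule.add_mem _ (Submodule.sub_mem _ hfa hgb) h1
  rwa [show f - incl k K W a - (g - incl k K W b) + (incl k K W a - incl k K W b) = f - g by
    ring] at h2

theorem Lifts.ne_zero [IsAlgClosed W] (hB : IsBaseChange D Dbar) (hK : IsFunctionFieldOne k K)
    (hD : 0 ≤ D) {α : PrincipalParts D} (hα : α ≠ 0) {f : FBar k K W} (hf : Lifts Dbar α f) :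
    f ≠ 0 := by
  rintro rfl
  obtain ⟨a, rfl, ha⟩ := hf
  rw [zero_sub] at ha
  exact hα ((Submodule.Quotient.mk_eq_zero _).2
    (hB.mem_regularAlong hK hD (neg_mem_iff.1 ha)))

variable [Fintype k] [IsAlgClosed W]

theorem twistFun_mem_regularAlong (hB : IsBaseChange D Dbar) {f : FBar k K W}
    (hf : f ∈ regularAlong Dbar) : twistFun 1 f ∈ regularAlong Dbar := by
  intro x hx
  have := hf (Point.twist (-1) x) (by
    rw [Finset.mem_coe, Finsupp.mem_support_iff, ← twistDiv_apply, hB.twistDiv_eq]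
    exact Finsupp.mem_support_iff.1 hx)
  rwa [Point.twist_val, neg_neg] at this

theorem existsUnique_lift (hK : IsFunctionFieldOne k K) {E : DivisorBar k K W} (hD : 0 ≤ D)
    (hB : IsBaseChange D Dbar) (haway : Away Dbar E)
    (hdeg : degree E = genus W (FBar k K W) - 1) (hE : H0 E = ⊥) (α : PrincipalParts D) :
    ∃! ψ, ψ ∈ Psi Dbar E ∧ Lifts Dbar α ψ := by
  have hF := isFunctionFieldOne_FBar W hK
  obtain ⟨a, rfl⟩ := Submodule.Quotient.mk_surjective _ α
  obtain ⟨ψ, hψ, hψa⟩ := exists_lift hF (hB.nonneg hD) haway hdeg hE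
    (hB.incl_mem_polesAlong a.2)
  refine ⟨ψ, ⟨⟨hψ, ?_⟩, a, rfl, hψa⟩, ?_⟩
  · have h1 := twistFun_mem_regularAlong hB hψa
    rw [map_sub, twistFun_one_incl] at h1
    have h2 := Submodule.sub_mem _ hψa h1
    rwa [sub_sub_sub_cancel_right] at h2
  · rintro ψ' ⟨⟨hψ', -⟩, hlift⟩
    have h1 := Lifts.sub_mem hB hlift ⟨a, rfl, hψa⟩
    have h2 := mem_H0_of_regularAlong haway (Submodule.sub_mem _ hψ' hψ) h1
    rw [hE] at h2
    exact sub_eq_zero.1 h2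

/-- The lifting of a nonzero principal part does not vanish at `ξ`. -/
theorem val_lift_eq_one (hK : IsFunctionFieldOne k K) {ξ η : PointBar k K W}
    {E : DivisorBar k K W} (hS : IsShtuka D Dbar ξ η E) (hN : IsNondegenerate Dbar ξ η E)
    (hE : H0 E = ⊥) (hξE : E ξ = 0) {α : PrincipalParts D} (hα : α ≠ 0) {ψ : FBar k K W}
    (hψ : ψ ∈ Psi Dbar E) (hlift : Lifts Dbar α ψ) : ξ.val ψ = 1 := by
  have hF := isFunctionFieldOne_FBar W hK
  have hB := hS.baseChange
  have hξD : Dbar ξ = 0 := Finsupp.notMem_support_iff.1 hS.basepoint_not_mem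
  obtain ⟨φ, hφ1, hφ⟩ := hS.classEq
  have hle : ξ.val ψ ≤ 1 := by
    have := mem_H0.1 hψ.1 ξ
    rwa [Finsupp.add_apply, hξE, hξD, add_zero, WithZero.exp_zero] at this
  by_contra hne
  have hlt := lt_one_iff.1 (lt_of_le_of_ne hle hne)
  have hψξ : ψ ∈ H0 (E + Dbar - Finsupp.single ξ 1) := by
    rw [mem_H0]
    intro x
    by_cases hx : x = ξ
    · subst hx
      simpa [hξE, hξD] using hlt
    · simpa [Finsupp.single_eq_of_ne hx] using mem_H0.1 hψ.1 x
  have hφ' : IsDivisorOf (E + Dbar - twistDiv 1 (E + Dbar) -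
      (-Finsupp.single (Point.twist 1 ξ) 1 + Finsupp.single η 1)) φ := by
    rwa [twistDiv_add, hB.twistDiv_eq, add_sub_add_right_eq_sub]
  have hτ : tau φ ψ ∈ H0 (E + Dbar) := by
    rw [sub_eq_add_neg, ← tau_mem_iff hφ'] at hψξ
    refine H0_mono ?_ hψξ
    have : twistDiv 1 (-Finsupp.single ξ 1 : DivisorBar k K W) =
        -Finsupp.single (Point.twist 1 ξ) 1 := by
      rw [← Finsupp.single_neg, twistDiv_single, Finsupp.single_neg]
    rw [this, neg_add_cancel_right]
    exact sub_le_self _ (Finsupp.single_nonneg.2 zero_le_one)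
  -- The difference is `-(τ ψ)(φ - 1)`: the zero of `φ - 1` along `D` cancels the pole of `τ ψ`.
  have hreg : tau φ ψ - twistFun 1 ψ ∈ regularAlong Dbar := by
    intro x hx
    have h1 : tau φ ψ - twistFun 1 ψ = -(tau φ ψ * (φ - 1)) := by
      rw [tau_apply]
      have := hφ.1
      field_simp
      ring
    have h2 := mem_H0.1 hτ x
    rw [Finsupp.add_apply, away_apply hS.away hx, zero_add] at h2
    rw [h1, Valuation.map_neg, map_mul]
    refine (mul_le_mul' h2 (hφ1 x hx)).trans ?_
    rw [← WithZero.exp_add, add_neg_cancel]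
    exact le_rfl
  have hfix : tau φ ψ = ψ := by
    have h2 : tau φ ψ - ψ ∈ regularAlong Dbar := by
      have h4 := Submodule.add_mem _ hreg (Submodule.neg_mem _ hψ.2)
      rwa [neg_sub, sub_add_sub_cancel] at h4
    have h3 := mem_H0_of_regularAlong hS.away (Submodule.sub_mem _ hτ hψ.1) h2
    rw [hE] at h3
    exact sub_eq_zero.1 h3
  have hdeg : 0 ≤ degree (E + Dbar) := by
    have := hB.degree_pos hK hS.conductor_effective hS.conductor_ne_zero
    have := genus_nonneg hF
    rw [degree_add, hS.degree_eq]
    omega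
  obtain ⟨N, hN'⟩ := Int.eq_ofNat_of_zero_le hdeg
  have hη : ∀ i < N, Point.twist (i : ℤ) η ≠ ξ := fun i hi h =>
    hN (-i) (by omega) (by have := genus_nonneg hF; omega) (by
      rw [← h, ← Point.twist_add, neg_add_cancel, Point.twist_zero])
  have horb := mem_H0_sub_orbitDiv hφ' (U := {ψ}) (by rintro _ rfl; exact hψξ)
    (by rintro _ rfl; exact ⟨_, rfl, hfix⟩) hη ψ rfl
  -- With `N = deg (E + D)`, the `N` orbit points and `ξ` itself leave a divisor of degree `-1`.
  have hbot := mem_H0_sub_add hψξ horb (orbitDiv_apply_eq_zero hη) rfl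
  rw [H0_eq_bot_of_degree_neg hF (by
    rw [degree_sub, degree_sub, degree_single, degree_orbitDiv, hN']
    simp)] at hbot
  exact hlift.ne_zero hB hK hS.conductor_effective hα hbot

theorem IsShtuka.H0_eq_bot (hK : IsFunctionFieldOne k K) {ξ η : PointBar k K W}
    {E : DivisorBar k K W} (hS : IsShtuka D Dbar ξ η E) (hN : IsNondegenerate Dbar ξ η E) :
    H0 E = ⊥ := by
  obtain ⟨φ, -, hφ⟩ := hS.classEq
  refine H0_eq_bot_of_nondegenerate (isFunctionFieldOne_FBar W hK) hφ hS.degree_eq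
    fun i h1 h2 => hN i ?_ h2
  -- As `deg D ≥ 1`, `deg (E + D) ≥ g`, so the excluded range contains `1 - g ≤ i ≤ g`.
  have := hS.baseChange.degree_pos hK hS.conductor_effective hS.conductor_ne_zero
  rw [degree_add, hS.degree_eq]
  omega

end Lifting

/-! ### The determinants -/

section Determinant

variable {W F : Type*} [Field W] [Field F] [Algebra W F] [IsAlgClosed W]

/-- Adding multiples of the other rows to row `0` replaces `a` by `ψ`, which vanishes at every `p
j`; expansion along that row leaves a single term. -/
theorem det_evalAt_cons (hF : IsFunctionFieldOne W F) {n : ℕ} {ξ : Point W F}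
    {p : Fin n → Point W F} {f : Fin n → F} {a ψ : F} {c : Fin n → W}
    (hψ : ψ = a + ∑ i, c i • f i)
    (ha : ∀ j, Point.val ((Fin.cons ξ p : Fin (n + 1) → Point W F) j) a ≤ 1)
    (hf : ∀ j i, Point.val ((Fin.cons ξ p : Fin (n + 1) → Point W F) j) (f i) ≤ 1)
    (hψp : ∀ j, (p j).val ψ < 1) :
    (Matrix.of fun i j : Fin (n + 1) => evalAt ((Fin.cons ξ p : Fin (n + 1) → Point W F) j)
      ((Fin.cons a f : Fin (n + 1) → F) i)).det =
      evalAt ξ ψ * (Matrix.of fun i j => evalAt (p j) (f i)).det := by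
  set M := Matrix.of fun i j : Fin (n + 1) => evalAt ((Fin.cons ξ p : Fin (n + 1) → Point W F) j)
      ((Fin.cons a f : Fin (n + 1) → F) i)
  have hrow : ∑ i, (Fin.cons 1 c : Fin (n + 1) → W) i • M i = fun j =>
      evalAt ((Fin.cons ξ p : Fin (n + 1) → Point W F) j) ψ := by
    ext j
    rw [hψ, evalAt_add hF (ha j), evalAt_sum hF _ _ (hf j), Fin.sum_univ_succ]
    · simp [M]
    · exact Valuation.map_sum_le _ fun i _ => (Point.val_smul_le _ _ _).trans (hf j i)
  have hdet := Matrix.det_updateRow_sum M 0 (Fin.cons 1 c)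
  rw [Fin.cons_zero, one_smul, hrow] at hdet
  rw [← hdet, Matrix.det_succ_row_zero, Fin.sum_univ_succ]
  rw [Finset.sum_eq_zero, add_zero]
  · simp only [Fin.val_zero, pow_zero, one_mul, Matrix.updateRow_self, Fin.cons_zero]
    congr 2
  · intro j _
    rw [Matrix.updateRow_self, Fin.cons_succ, (evalAt_eq_zero_iff hF (hψp j).le).2 (hψp j)]
    simp

/-- A dependence among the rows is a section of `𝒪(E₁)` vanishing at every `p j`. As `E₂` has
multiplicity at most one, simple zeros already place it in `H⁰(E₁ - E₂) = 0`. -/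
theorem det_evalAt_ne_zero (hF : IsFunctionFieldOne W F) {E₁ E₂ : Divisor W F}
    (hE₂' : ∀ x, E₂ x ≤ 1) (hE₁₂ : Disjoint E₁.support E₂.support) {n : ℕ}
    {p : Fin n → Point W F} (hp : E₂ = ∑ i, Finsupp.single (p i) 1)
    (hbot : H0 (E₁ - E₂) = ⊥) (f : Module.Basis (Fin n) W (H0 E₁)) :
    (Matrix.of fun i j => evalAt (p j) (f i : F)).det ≠ 0 := by
  intro h0
  obtain ⟨v, hv0, hv⟩ := Matrix.exists_vecMul_eq_zero_iff.2 h0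
  have hE₂p : ∀ j, 1 ≤ E₂ (p j) := by
    classical
    intro j
    rw [hp, Finsupp.finsetSum_apply]
    refine le_trans ?_ (Finset.single_le_sum (f := fun i => Finsupp.single (p i) (1 : ℤ) (p j))
      (fun i _ => ?_) (Finset.mem_univ j))
    · simp
    · rw [Finsupp.single_apply]
      split_ifs <;> simp
  have hE₁p : ∀ j, E₁ (p j) = 0 := fun j => Finsupp.notMem_support_iff.1
    (Finset.disjoint_right.1 hE₁₂ (Finsupp.mem_support_iff.2 (by have := hE₂p j; omega)))
  have hreg : ∀ h ∈ H0 E₁, ∀ j, (p j).val h ≤ 1 := fun h hh j => by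
    have := mem_H0.1 hh (p j)
    rwa [hE₁p] at this
  let h : H0 E₁ := ∑ i, v i • f i
  have hh : (h : F) = ∑ i, v i • (f i : F) := by simp [h]
  have hval : ∀ j, (p j).val (h : F) < 1 := by
    intro j
    rw [← evalAt_eq_zero_iff hF (hreg h h.2 j), hh,
      evalAt_sum hF _ _ fun i => hreg _ (f i).2 j]
    exact congrFun hv j
  have hmem : (h : F) ∈ H0 (E₁ - E₂) := by
    rw [mem_H0]
    intro x
    by_cases hx : ∃ j, p j = x
    · obtain ⟨j, rfl⟩ := hx
      have : (E₁ - E₂) (p j) = -1 := by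
        have := hE₂p j
        have := hE₂' (p j)
        rw [Finsupp.sub_apply, hE₁p]
        omega
      rw [this]
      exact lt_one_iff.1 (hval j)
    · push Not at hx
      have : E₂ x = 0 := by
        rw [hp, Finsupp.finsetSum_apply]
        exact Finset.sum_eq_zero fun i _ => Finsupp.single_eq_of_ne (hx i).symm
      rw [Finsupp.sub_apply, this, sub_zero]
      exact mem_H0.1 h.2 x
  rw [hbot] at hmem
  have hzero : h = 0 := Subtype.ext hmem
  exact hv0 (funext (Fintype.linearIndependent_iff.1 f.linearIndependent v hzero))

end Determinant

end Shtuka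

end

/-! ### The determinant formula -/

theorem proposition5p5 {k K W : Type*} [Field k] [Fintype k] [Field K] [Algebra k K]
    (hK : Shtuka.IsFunctionFieldOne k K)
    [Field W] [IsAlgClosed W] [Algebra k W] [IsDomain (W ⊗[k] K)]
    (D : Shtuka.Divisor k K) (Dbar : Shtuka.DivisorBar k K W)
    (ξ η : Shtuka.PointBar k K W) (E : Shtuka.DivisorBar k K W)
    (hS : Shtuka.IsShtuka D Dbar ξ η E) (hN : Shtuka.IsNondegenerate Dbar ξ η E)
    (α β : Shtuka.PrincipalParts D) (hα : α ≠ 0) (hβ : β ≠ 0)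
    (E₁ E₂ : Shtuka.DivisorBar k K W) (hE : E = E₁ - E₂)
    (hE₁D : Shtuka.Away Dbar E₁) (hE₂D : Shtuka.Away Dbar E₂)
    (hE₂ : 0 ≤ E₂) (hE₂' : ∀ x, E₂ x ≤ 1)
    (hE₁₂ : Disjoint E₁.support E₂.support)
    (hξ₁ : ξ ∉ E₁.support) (hξ₂ : ξ ∉ E₂.support)
    (n : ℕ) (p : Fin n → Shtuka.PointBar k K W)
    (hp : E₂ = ∑ i, Finsupp.single (p i) 1)
    (f : Module.Basis (Fin n) W (Shtuka.H0 E₁))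
    (a b : Shtuka.FBar k K W)
    (ha : a ∈ Shtuka.H0 (E₁ + Dbar)) (haα : Shtuka.Lifts Dbar α a)
    (hb : b ∈ Shtuka.H0 (E₁ + Dbar)) (hbβ : Shtuka.Lifts Dbar β b) :
    let pts : Fin (n + 1) → Shtuka.PointBar k K W := Fin.cons ξ p
    let fs : Fin (n + 1) → Shtuka.FBar k K W := Fin.cons a fun i => (f i : Shtuka.FBar k K W)
    let gs : Fin (n + 1) → Shtuka.FBar k K W := Fin.cons b fun i => (f i : Shtuka.FBar k K W)
    let detf : W := (Matrix.of fun i j => Shtuka.evalAt (pts j) (fs i)).det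
    let detg : W := (Matrix.of fun i j => Shtuka.evalAt (pts j) (gs i)).det
    (∃! ψ, ψ ∈ Shtuka.Psi Dbar E ∧ Shtuka.Lifts Dbar α ψ) ∧
    (∃! ψ, ψ ∈ Shtuka.Psi Dbar E ∧ Shtuka.Lifts Dbar β ψ) ∧
    detg * Shtuka.catalanDrinfeld Dbar ξ E α β = detf ∧ detg ≠ 0 ∧ detf ≠ 0 := by
  intro pts fs gs detf detg
  have hF := Shtuka.isFunctionFieldOne_FBar W hK
  have hbot := hS.H0_eq_bot hK hN
  have hex := Shtuka.existsUnique_lift hK hS.conductor_effective hS.baseChange hS.away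
    hS.degree_eq hbot
  have hξE₁ : E₁ ξ = 0 := Finsupp.notMem_support_iff.1 hξ₁
  have hξE : E ξ = 0 := by
    rw [hE, Finsupp.sub_apply, hξE₁, Finsupp.notMem_support_iff.1 hξ₂, sub_zero]
  have hpE₂ : ∀ j, p j ∈ E₂.support := by
    classical
    intro j
    rw [Finsupp.mem_support_iff, hp, Finsupp.finsetSum_apply]
    have := Finset.single_le_sum (f := fun i => Finsupp.single (p i) (1 : ℤ) (p j))
      (fun i _ => by rw [Finsupp.single_apply]; split_ifs <;> simp) (Finset.mem_univ j)
    rw [Finsupp.single_eq_same] at this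
    omega
  have hE₂p : ∀ j, E₂ (p j) = 1 := fun j => by
    have h1 := hE₂' (p j)
    have h2 : 0 ≤ E₂ (p j) := hE₂ (p j)
    have h3 := Finsupp.mem_support_iff.1 (hpE₂ j)
    omega
  have hpts : ∀ j, (E₁ + Dbar) (pts j) = 0 ∧ E₁ (pts j) = 0 := by
    intro j
    refine Fin.cases ?_ (fun j => ?_) j
    · have h1 := Finsupp.notMem_support_iff.1 hS.basepoint_not_mem
      simp [pts, h1, hξE₁]
    · have h1 : E₁ (p j) = 0 :=
        Finsupp.notMem_support_iff.1 (Finset.disjoint_right.1 hE₁₂ (hpE₂ j))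
      have h2 : Dbar (p j) = 0 :=
        Finsupp.notMem_support_iff.1 (Finset.disjoint_right.1 hE₂D (hpE₂ j))
      simp [pts, h1, h2]
  have hreg : ∀ h ∈ Shtuka.H0 (E₁ + Dbar), ∀ j, (pts j).val h ≤ 1 := fun h hh j => by
    have := Shtuka.mem_H0.1 hh (pts j)
    rwa [(hpts j).1] at this
  have hregf : ∀ j i, (pts j).val (f i : Shtuka.FBar k K W) ≤ 1 := fun j i => by
    have := Shtuka.mem_H0.1 (f i).2 (pts j)
    rwa [(hpts j).2] at this
  have hminor := Shtuka.det_evalAt_ne_zero hF hE₂' hE₁₂ hp (hE ▸ hbot) f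
  set m := (Matrix.of fun i j => Shtuka.evalAt (p j) (f i : Shtuka.FBar k K W)).det
  have key : ∀ γ : Shtuka.PrincipalParts D, γ ≠ 0 → ∀ c : Shtuka.FBar k K W,
      c ∈ Shtuka.H0 (E₁ + Dbar) → Shtuka.Lifts Dbar γ c →
      ξ.val (Shtuka.psiLift Dbar E γ) = 1 ∧
      (Matrix.of fun i j => Shtuka.evalAt (pts j)
        ((Fin.cons c fun i => (f i : Shtuka.FBar k K W) :
          Fin (n + 1) → Shtuka.FBar k K W) i)).det =
        Shtuka.evalAt ξ (Shtuka.psiLift Dbar E γ) * m := by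
    intro γ hγ c hc hcγ
    obtain ⟨hψ, hψγ⟩ : Shtuka.psiLift Dbar E γ ∈ Shtuka.Psi Dbar E ∧
        Shtuka.Lifts Dbar γ (Shtuka.psiLift Dbar E γ) :=
      Classical.epsilon_spec (hex γ).exists
    refine ⟨Shtuka.val_lift_eq_one hK hS hN hbot hξE hγ hψ hψγ, ?_⟩
    set ψ := Shtuka.psiLift Dbar E γ
    have hψE₁ : ψ ∈ Shtuka.H0 (E₁ + Dbar) := by
      refine Shtuka.H0_mono ?_ hψ.1
      rw [hE]
      exact add_le_add_left (sub_le_self _ hE₂) _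
    -- Both functions lift `γ`, so their poles along `D` cancel; the coordinates of the difference
    -- in the basis `f` are the multipliers of the row operation.
    have hdiff : ψ - c ∈ Shtuka.H0 E₁ := Shtuka.mem_H0_of_regularAlong hE₁D
      (Submodule.sub_mem _ hψE₁ hc) (Shtuka.Lifts.sub_mem hS.baseChange hψγ hcγ)
    refine Shtuka.det_evalAt_cons hF (c := f.repr ⟨ψ - c, hdiff⟩) ?_ (hreg c hc) hregf ?_
    · have := congrArg Subtype.val (f.sum_repr ⟨ψ - c, hdiff⟩)
      rw [Submodule.coe_sum] at this
      simp only [Submodule.coe_smul] at this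
      rw [this, add_sub_cancel]
    · intro j
      have h1 := Shtuka.mem_H0.1 hψ.1 (p j)
      have h2 := (hpts j.succ).1
      simp only [pts, Fin.cons_succ] at h2
      rw [show (E + Dbar) (p j) = -1 by
        rw [hE, sub_add_eq_add_sub, Finsupp.sub_apply, h2, hE₂p]; rfl] at h1
      exact Shtuka.lt_one_iff.2 h1
  obtain ⟨hα1, hdetf⟩ := key α hα a ha haα
  obtain ⟨hβ1, hdetg⟩ := key β hβ b hb hbβ
  have hne : ∀ ψ : Shtuka.FBar k K W, ξ.val ψ = 1 → Shtuka.evalAt ξ ψ ≠ 0 := fun ψ h h0 =>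
    ((Shtuka.evalAt_eq_zero_iff hF h.le).1 h0).ne h
  refine ⟨hex α, hex β, ?_, ?_, ?_⟩
  · change detg = _ at hdetg
    change detf = _ at hdetf
    -- The common minor `m` factors out, leaving `ψ_β(ξ) · (ψ_α/ψ_β)(ξ) = ψ_α(ξ)`, valid since `ψ_β`
    -- is a unit at `ξ`.
    rw [hdetg, hdetf, Shtuka.catalanDrinfeld, mul_right_comm,
      Shtuka.evalAt_div_mul hF hα1.le hβ1]
  · change detg = _ at hdetg
    rw [hdetg]
    exact mul_ne_zero (hne _ hβ1) hminor
  · change detf = _ at hdetf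
    rw [hdetf]
    exact mul_ne_zero (hne _ hα1) hminor
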